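/- **Setting.** A principal and $n\ge 2$ agents decide on a project, with $1\le k\le n$. The state $\theta\in\Theta=[-1,1]$ is drawn from an atomless distribution $F$. If the project is launched, the principal gets $u(\theta)=\theta$ and agent $i$ gets $v_i(\theta)=\alpha_i\theta+\beta_i$, where $\alpha_i\in\{-1,1\}$, $\beta_i\in(-1,1)$, and the acceptance thresholds $\delta_i=-\beta_i/\alpha_i$ are pairwise distinct; otherwise everybody gets $0$. A test $t=(\mathcal S,\pi)$ consists of a measurable signal space $\mathcal S$ and a Markov kernel $\pi(\cdot\mid\theta)$ from $\Theta$ to $\mathcal S$. The principal publicly chooses a test and privately observes $s\sim\pi(\cdot\mid\theta)$. She either forgoes the project or proposes it at a cost $c>0$; after a proposal she sends one common cheap-talk message $m$, from a measurable message space $\mathcal M$ that contains the signals, to all agents (public messaging). Each agent then accepts or rejects, and the project is launched iff it was proposed and at least $k$ agents accept. Independently across agents, each agent is mechanical with probability $\epsilon\in(0,1]$ and then accepts with probability $1/2$; otherwise he is rational and votes in his own interest. **Equilibrium.** Given a test, an assessment consists of proposal probabilities $\gamma(s)\in[0,1]$, a public messaging strategy $\sigma(\cdot\mid s)\in\Delta(\mathcal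 M)$, intended acceptance probabilities $\tau_i(m)\in[0,1]$ of the rational types, and beliefs $\psi_i(m)\in\Delta(\Theta)$. It is an equilibrium (weak PBE) if: the principal's proposal and messaging strategies are optimal after almost every signal, given her posterior; every rational agent's vote is optimal after every message, given his belief and the others' strategies; and the beliefs are obtained by Bayes' rule from the message and the event that the project is proposed, and are arbitrary off the equilibrium path. It induces the outcome $\omega=(\omega_p,\omega_\ell)$, where $\omega_p(\theta)$ is the probability of a proposal in state $\theta$ and $\omega_\ell(\theta)$ the probability of launch conditional on a proposal in state $\theta$. Let $\Omega_{\mathsf{pub}}(t)$ be the set of outcomes induced by equilibria under $t$. A test is optimal if it solves $$\max_{t}\ \max_{\omega\in\Omega_{\mathsf{pub}}(t)}\int_\Theta\bigl[u(\theta)\,\omega_\ell(\theta)-c\bigr]\,\omega_p(\theta)\,dF(\theta),$$ the first maximum being over all tests. **Bi-pooled threshold tests.** A test with $\mathcal S=\{s^-,s_1^+,s_2^+\}$ is a bi-pooled threshold test if there are $\tilde\theta\in[-1,1]$ and a monotone partition $\Theta_1\cup\Theta_2\cup\Theta_3=[\tilde\theta,1]$ (disjoint, successively ordered, possibly empty cells)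 such that $\pi(s^-\mid\theta)=1$ for all $\theta\in[-1,\tilde\theta)$, $\pi(s_1^+\mid\theta)=1$ for all $\theta\in\Theta_1\cup\Theta_3$, and $\pi(s_2^+\mid\theta)=1$ for all $\theta\in\Theta_2$. **Proposition (Optimal Public Test).** Under public messaging there exists an optimal test that is a bi-pooled threshold test with signals $\{s^-,s_1^+,s_2^+\}$. Its optimal value is attained in an equilibrium in which the principal forgoes the project upon $s^-$ and, upon either $s_1^+$ or $s_2^+$, proposes the project and truthfully reports the signal to all agents. -/

import Mathlib

open MeasureTheory ProbabilityTheory Set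

universe w₁ w₂ w₃

noncomputable section

namespace PublicTest

/-- The state space `Θ = [-1, 1]`. -/
abbrev State : Type := ↥(Set.Icc (-1 : ℝ) 1)

instance : Nonempty State := ⟨⟨0, by norm_num⟩⟩

/-- Primitives of the game with `n` agents: the number `k` of acceptances needed for launch, the
probability `ε` that an agent is mechanical, the proposal cost `c`, and the payoffs from launching
of the principal (`u`) and of the agents (`v i`). -/
structure Game (n : ℕ) where
  k : ℕ
  ε : ℝ
  c : ℝ
  u : State → ℝ
  v : Fin n → State → ℝ

/-- The linear environment: `u(θ) = θ` and `v_i(θ) = α_i θ + β_i`. -/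
def linearGame {n : ℕ} (k : ℕ) (ε c : ℝ) (α β : Fin n → ℝ) : Game n where
  k := k
  ε := ε
  c := c
  u := fun θ => (θ : ℝ)
  v := fun i θ => α i * (θ : ℝ) + β i

/-- A test with signal space `S`: a (stochastic) signal generation rule. -/
structure Test (S : Type*) [MeasurableSpace S] where
  rule : Kernel State S
  isMarkov : IsMarkovKernel rule

attribute [instance] Test.isMarkov

/-- An assessment of the continuation game under public messaging, for the signal space `S` and
the message space `M`: the probability `propose s` of proposing after the signal `s`, the law
`message s` of the common message sent after a proposal at `s`, the intended acceptance probability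
`vote i m` of the rational type of agent `i`, and his belief `belief i m` about the state. -/
structure Assessment (n : ℕ) (S M : Type*) [MeasurableSpace S] [MeasurableSpace M] where
  propose : S → ℝ
  measurable_propose : Measurable propose
  propose_mem : ∀ s, propose s ∈ Set.Icc (0 : ℝ) 1
  message : Kernel S M
  message_isMarkov : IsMarkovKernel message
  vote : Fin n → M → ℝ
  measurable_vote : ∀ i, Measurable (vote i)
  vote_mem : ∀ i m, vote i m ∈ Set.Icc (0 : ℝ) 1
  belief : Fin n → Kernel M State
  belief_isMarkov : ∀ i, IsMarkovKernel (belief i)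

attribute [instance] Assessment.message_isMarkov Assessment.belief_isMarkov

/-- The probability that at least `k` agents accept, if they accept independently, agent `i` with
probability `a i`. -/
def atLeast {n : ℕ} (k : ℕ) (a : Fin n → ℝ) : ℝ :=
  ∑ A : Finset (Fin n) with k ≤ A.card, (∏ i ∈ A, a i) * ∏ i ∈ Aᶜ, (1 - a i)

variable {n : ℕ} {S M : Type*} [MeasurableSpace S] [MeasurableSpace M]

/-- The actual acceptance probability of agent `i` after the public message `m`; a mechanical type
accepts with probability one half. -/
def acceptProb (G : Game n) (ρ : Assessment n S M) (m : M) (i : Fin n) : ℝ :=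
  (1 - G.ε) * ρ.vote i m + G.ε / 2

/-- The probability that the project is launched, given a proposal and the public message `m`. -/
def launchProb (G : Game n) (ρ : Assessment n S M) (m : M) : ℝ :=
  atLeast G.k (acceptProb G ρ m)

/-- The principal's expected payoff from the project being launched, given the signal `s`. -/
def principalValue (G : Game n) (F : Measure State) [IsProbabilityMeasure F] (t : Test S)
    (s : S) : ℝ :=
  ∫ θ, G.u θ ∂(posterior t.rule F s)

/-- The principal's expected net payoff from proposing after `s` and then using `ρ.message`. -/
def proposalValue (G : Game n) (F : Measure State) [IsProbabilityMeasure F] (t : Test S)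
    (ρ : Assessment n S M) (s : S) : ℝ :=
  ∫ m, (principalValue G F t s * launchProb G ρ m - G.c) ∂(ρ.message s)

/-- Sequential rationality of the principal after (almost) every signal: no message does better
after a proposal, and no proposal probability does better given the continuation. -/
def PrincipalRational (G : Game n) (F : Measure State) [IsProbabilityMeasure F] (t : Test S)
    (ρ : Assessment n S M) : Prop :=
  ∀ᵐ s ∂(F.bind t.rule),
    (∀ m, principalValue G F t s * launchProb G ρ m - G.c ≤ proposalValue G F t ρ s) ∧
    ∀ g ∈ Set.Icc (0 : ℝ) 1, g * proposalValue G F t ρ s ≤ ρ.propose s * proposalValue G F t ρ s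

/-- Sequential rationality of the rational type of every agent after every message, given his
belief and the acceptance probabilities of the others. -/
def AgentsRational (G : Game n) (ρ : Assessment n S M) : Prop :=
  ∀ i m, ∀ x ∈ Set.Icc (0 : ℝ) 1,
    (∫ θ, G.v i θ ∂(ρ.belief i m)) *
        atLeast G.k (Function.update (acceptProb G ρ m) i x) ≤
      (∫ θ, G.v i θ ∂(ρ.belief i m)) *
        atLeast G.k (Function.update (acceptProb G ρ m) i (ρ.vote i m))

/-- The joint law of the public message and the state on the event that the project is proposed
(a measure whose total mass is the probability of a proposal). -/
def proposalLaw (F : Measure State) (t : Test S) (ρ : Assessment n S M) : Measure (M × State) :=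
  (((F ⊗ₘ t.rule).withDensity (fun x => ENNReal.ofReal (ρ.propose x.2))) ⊗ₘ
    (ρ.message.comap Prod.snd measurable_snd)).map (fun y => (y.2, y.1.1))

/-- Bayes' rule: the agents' beliefs are a regular conditional law of the state given the public
message and the fact that the project is proposed (so they are free off the equilibrium path). -/
def BayesConsistent (F : Measure State) (t : Test S) (ρ : Assessment n S M) : Prop :=
  ∀ i, proposalLaw F t ρ = (proposalLaw F t ρ).fst ⊗ₘ ρ.belief i

/-- Weak perfect Bayesian equilibrium of the continuation game under public messaging. -/
structure IsPublicEquilibrium (G : Game n) (F : Measure State) [IsProbabilityMeasure F]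
    (t : Test S) (ρ : Assessment n S M) : Prop where
  principal : PrincipalRational G F t ρ
  agents : AgentsRational G ρ
  bayes : BayesConsistent F t ρ

/-- An outcome: the probability of a proposal in each state, and the probability of launch
conditional on a proposal in each state. -/
structure Outcome where
  p : State → ℝ
  l : State → ℝ
  p_mem : ∀ θ, p θ ∈ Set.Icc (0 : ℝ) 1
  l_mem : ∀ θ, l θ ∈ Set.Icc (0 : ℝ) 1

/-- The assessment `ρ` induces the outcome `ω` under the test `t`. -/
def Induces (G : Game n) (t : Test S) (ρ : Assessment n S M) (ω : Outcome) : Prop :=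
  ∀ θ, ω.p θ = ∫ s, ρ.propose s ∂(t.rule θ) ∧
    ω.p θ * ω.l θ = ∫ s, ρ.propose s * ∫ m, launchProb G ρ m ∂(ρ.message s) ∂(t.rule θ)

/-- The outcomes implementable by the test `t` under public messaging with message space `M`. -/
def publicOutcomes (M : Type*) [MeasurableSpace M] (G : Game n) (F : Measure State)
    [IsProbabilityMeasure F] (t : Test S) : Set Outcome :=
  {ω | ∃ ρ : Assessment n S M, IsPublicEquilibrium G F t ρ ∧ Induces G t ρ ω}

/-- The principal's ex ante payoff from an outcome. -/
def payoff (G : Game n) (F : Measure State) (ω : Outcome) : ℝ :=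
  ∫ θ, (G.u θ * ω.l θ - G.c) * ω.p θ ∂F

/-- The three signals `s⁻`, `s₁⁺`, `s₂⁺`. -/
inductive Signal : Type
  | minus
  | plus₁
  | plus₂

instance : MeasurableSpace Signal := ⊤

/-- Bi-pooled threshold tests. The three cells of the monotone partition of `[a, 1]` are ordered
and may be empty. -/
def IsBiPooledThreshold (t : Test Signal) : Prop :=
  ∃ (a : State) (Θ₁ Θ₂ Θ₃ : Set State),
    Θ₁ ∪ Θ₂ ∪ Θ₃ = Set.Ici a ∧
    (∀ x ∈ Θ₁, ∀ y ∈ Θ₂, x < y) ∧ (∀ x ∈ Θ₂, ∀ y ∈ Θ₃, x < y) ∧ (∀ x ∈ Θ₁, ∀ y ∈ Θ₃, x < y) ∧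
    (∀ θ < a, t.rule θ {Signal.minus} = 1) ∧
    (∀ θ ∈ Θ₁ ∪ Θ₃, t.rule θ {Signal.plus₁} = 1) ∧
    (∀ θ ∈ Θ₂, t.rule θ {Signal.plus₂} = 1)

end PublicTest

end

/-! Consider an equilibrium with positive payoff. Since c > 0, the principal proposes only when her
posterior mean is positive, so she then wants the launch probability as high as possible. Hence it
equals one maximal level ℓ almost surely after a proposal (`exists_launch_level`). Messages are
public, so on path all agents share one belief, and its mean lies in the compact set X of means at
which mutually optimal votes produce ℓ (`ae_mean_mem`). With p = c / ℓ, the payoff divided by ℓ,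
called W, is the integral of θ − p over the proposed part of F, and each message pools states to a
mean in X.

Only two facts about W are retained. Weak duality: if a nonnegative convex w with at most two kinks
dominates x − p on X, Jensen's inequality for each message gives W ≤ ∫ w dF
(`dualBound_of_equilibrium`). Deviation: always proposing is available, so E θ − p ≤ W
(`always_propose_le`).

From these, `exists_biPool` produces a threshold partition with at most two pools and value at least
W. Without the constraint X one would pool [p, 1], with mean e, say. What matters are the admissible
means y ≤ e ≤ z nearest to e. Either [p, 1] splits into pools of means y and z, or the threshold is
moved until the pools fit; in the latter case a majorant that touches x − p at the pool means and is
affine on each pool shows that nothing is lost. The deviation bound stops the threshold from being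
pushed below −1, and it also makes forgoing optimal below the threshold.

Conversely, a plan made of thresholds, means and votes is played by truthful reporting: both
messages lead to the same ℓ, so there is nothing to gain from lying
(`exists_equilibrium_of_isFeasible`). Feasible plans form a compact set with a continuous value, so
a best one exists. It also beats equilibria with nonpositive payoff, because always or never
proposing is feasible. -/

noncomputable section

namespace PublicTest

/-! ### Partial masses, partial moments and tail integrals -/

/-- `TailData M₀ M₁`: `M₀` and `M₁` behave as the partial mass and the partial first moment of an
atomless probability measure on `[-1, 1]`. -/
structure TailData (M₀ M₁ : ℝ → ℝ) : Prop where
  cont₀ : Continuous M₀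
  cont₁ : Continuous M₁
  mono : Monotone M₀
  lower : ∀ {a b}, a ≤ b → a * (M₀ b - M₀ a) ≤ M₁ b - M₁ a
  upper : ∀ {a b}, a ≤ b → M₁ b - M₁ a ≤ b * (M₀ b - M₀ a)
  zero : M₀ (-1) = 0
  one : M₀ 1 = 1

/-- The integral of `θ - z` over the upper tail `[b, 1]`. -/
def tail (M₀ M₁ : ℝ → ℝ) (z b : ℝ) : ℝ := (M₁ 1 - M₁ b) - z * (1 - M₀ b)

namespace TailData

variable {M₀ M₁ : ℝ → ℝ}

lemma continuous_tail (h : TailData M₀ M₁) (z : ℝ) : Continuous (tail M₀ M₁ z) := by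
  have h0 := h.cont₀
  have h1 := h.cont₁
  unfold tail
  fun_prop

lemma tail_one (h : TailData M₀ M₁) (z : ℝ) : tail M₀ M₁ z 1 = 0 := by
  simp [tail, h.one]

/-- The integrand θ − z is nonpositive below z and nonnegative above it, so the tail integral is
single-peaked in its left endpoint, with peak at z; this is the increasing side. -/
lemma tail_le_of_le (h : TailData M₀ M₁) {a b z : ℝ} (hab : a ≤ b) (hbz : b ≤ z) :
    tail M₀ M₁ z a ≤ tail M₀ M₁ z b := by
  have h1 := h.upper hab
  have h2 := mul_le_mul_of_nonneg_right hbz (sub_nonneg.2 (h.mono hab))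
  unfold tail
  linarith

lemma tail_le_of_ge (h : TailData M₀ M₁) {a b z : ℝ} (hab : a ≤ b) (hza : z ≤ a) :
    tail M₀ M₁ z b ≤ tail M₀ M₁ z a := by
  have h1 := h.lower hab
  have h2 := mul_le_mul_of_nonneg_right hza (sub_nonneg.2 (h.mono hab))
  unfold tail
  linarith

lemma tail_nonneg (h : TailData M₀ M₁) {b z : ℝ} (hb : b ≤ 1) (hzb : z ≤ b) :
    0 ≤ tail M₀ M₁ z b := by
  have := h.tail_le_of_ge hb hzb
  rwa [h.tail_one] at this

lemma moment_eq_of_mass_eq (h : TailData M₀ M₁) {a b : ℝ} (hab : M₀ a = M₀ b) :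
    M₁ a = M₁ b := by
  rcases le_total a b with hle | hle
  · have h1 := h.lower hle
    have h2 := h.upper hle
    rw [hab, sub_self, mul_zero] at h1 h2
    linarith
  · have h1 := h.lower hle
    have h2 := h.upper hle
    rw [hab, sub_self, mul_zero] at h1 h2
    linarith

/-- States have absolute value at most 1. The moment is thus 1-Lipschitz as a function of the mass,
even where quantiles jump over a gap of F. -/
lemma abs_moment_sub_le (h : TailData M₀ M₁) {a b : ℝ} (ha : a ∈ Icc (-1 : ℝ) 1)
    (hb : b ∈ Icc (-1 : ℝ) 1) : |M₁ b - M₁ a| ≤ |M₀ b - M₀ a| := by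
  wlog hab : a ≤ b generalizing a b
  · rw [abs_sub_comm, abs_sub_comm (M₀ b)]
    exact this hb ha (le_of_not_ge hab)
  have h1 := h.lower hab
  have h2 := h.upper hab
  have h3 := sub_nonneg.2 (h.mono hab)
  rw [abs_of_nonneg h3, abs_le]
  constructor <;> nlinarith [ha.1, hb.2]

/-- Some t > z still has mass above it, and that mass exceeds z by at least t − z. -/
lemma tail_pos (h : TailData M₀ M₁) {z : ℝ} (hz : M₀ z < 1) : 0 < tail M₀ M₁ z z := by
  have hz1 : z < 1 := by
    by_contra hcon
    have := h.mono (not_lt.1 hcon)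
    rw [h.one] at this
    linarith
  have hev : ∀ᶠ t in nhdsWithin z (Ioi z), M₀ t < 1 :=
    (h.cont₀.continuousAt.eventually_lt_const hz).filter_mono nhdsWithin_le_nhds
  have hev2 : ∀ᶠ t in nhdsWithin z (Ioi z), t ∈ Ioo z 1 := Ioo_mem_nhdsGT hz1
  obtain ⟨t, ht, ht2⟩ := (hev.and hev2).exists
  have h1 := h.tail_le_of_ge ht2.1.le le_rfl
  have h2 : (t - z) * (1 - M₀ t) ≤ tail M₀ M₁ z t := by
    have := h.lower ht2.2.le
    rw [h.one] at this
    unfold tail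
    linarith
  have h3 : 0 < (t - z) * (1 - M₀ t) := mul_pos (by linarith [ht2.1]) (by linarith)
  linarith

/-- The moving window: between two points there is an interval of prescribed mass with prescribed
mean, provided that the mean is bracketed by those of the lowest and highest such intervals. -/
lemma exists_window (h : TailData M₀ M₁) {a z m : ℝ} (ha : a ∈ Icc (-1 : ℝ) 1)
    (hm : 0 < m) (hma : m ≤ 1 - M₀ a)
    (hlow : ∀ q ∈ Icc a 1, M₀ q = M₀ a + m → M₁ q - M₁ a ≤ z * m)
    (hhigh : ∀ q ∈ Icc a 1, M₀ q = 1 - m → z * m ≤ M₁ 1 - M₁ q) :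
    ∃ b₁ b₂, a ≤ b₁ ∧ b₁ ≤ b₂ ∧ b₂ ≤ 1 ∧ M₀ b₂ - M₀ b₁ = m ∧ M₁ b₂ - M₁ b₁ = z * m := by
  -- The window is moved by mass, not by endpoint: a quantile q need not be continuous, but M₁ ∘ q
  -- is.
  have hq : ∀ u ∈ Icc (M₀ a) 1, ∃ b ∈ Icc a 1, M₀ b = u := by
    intro u hu
    have := intermediate_value_Icc ha.2 h.cont₀.continuousOn
    rw [h.one] at this
    exact this hu
  choose! q hqmem hq using hq
  have hqm : ∀ u ∈ Icc (M₀ a) 1, q u ∈ Icc (-1 : ℝ) 1 := fun u hu =>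
    ⟨ha.1.trans (hqmem u hu).1, (hqmem u hu).2⟩
  have hcont : ContinuousOn (fun u => M₁ (q u)) (Icc (M₀ a) 1) := by
    have : LipschitzOnWith 1 (fun u => M₁ (q u)) (Icc (M₀ a) 1) := by
      refine LipschitzOnWith.of_dist_le_mul fun u hu v hv => ?_
      have := h.abs_moment_sub_le (hqm v hv) (hqm u hu)
      rw [hq u hu, hq v hv] at this
      simpa [Real.dist_eq] using this
    exact this.continuousOn
  have hle : M₀ a ≤ 1 - m := by linarith
  have hG : ContinuousOn (fun u => M₁ (q (u + m)) - M₁ (q u)) (Icc (M₀ a) (1 - m)) := by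
    refine ContinuousOn.sub (hcont.comp (by fun_prop) ?_) (hcont.mono ?_)
    · intro u hu
      exact ⟨by linarith [hu.1], by linarith [hu.2]⟩
    · exact Icc_subset_Icc le_rfl (by linarith)
  -- The chosen quantiles of the extreme masses may differ from a and 1, but only across a null
  -- interval, which leaves the moment unchanged.
  have e1 : M₁ (q (M₀ a)) = M₁ a :=
    h.moment_eq_of_mass_eq (hq _ ⟨le_rfl, by linarith⟩)
  have e2 : M₁ (q (1 - m + m)) = M₁ 1 := by
    refine h.moment_eq_of_mass_eq ?_
    rw [hq _ ⟨by linarith, by linarith⟩, h.one]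
    ring
  have m1 : M₀ a + m ∈ Icc (M₀ a) 1 := ⟨by linarith, by linarith⟩
  have m2 : 1 - m ∈ Icc (M₀ a) 1 := ⟨by linarith, by linarith⟩
  have hz : z * m ∈ Icc (M₁ (q (M₀ a + m)) - M₁ (q (M₀ a)))
      (M₁ (q (1 - m + m)) - M₁ (q (1 - m))) := by
    rw [e1, e2]
    exact ⟨hlow _ (hqmem _ m1) (hq _ m1), hhigh _ (hqmem _ m2) (hq _ m2)⟩
  obtain ⟨u, hu, hGu⟩ := intermediate_value_Icc hle hG hz
  have hu1 : u ∈ Icc (M₀ a) 1 := ⟨hu.1, by linarith [hu.2]⟩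
  have hu2 : u + m ∈ Icc (M₀ a) 1 := ⟨by linarith [hu.1], by linarith [hu.2]⟩
  refine ⟨q u, q (u + m), (hqmem u hu1).1, ?_, (hqmem _ hu2).2, ?_, hGu⟩
  · by_contra hcon
    have := h.mono (not_le.1 hcon).le
    rw [hq u hu1, hq _ hu2] at this
    linarith
  · rw [hq u hu1, hq _ hu2]
    ring

/-! ### Dual bounds and bi-pools -/

/-- The value `W` (net of the cost `p` per unit of mass) is bounded by the convex piecewise affine
majorants of `x - p` on the set `X` of admissible means. -/
def DualBound (M₀ M₁ : ℝ → ℝ) (X : Set ℝ) (p W : ℝ) : Prop :=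
  ∀ κ s r a b : ℝ, 0 ≤ κ → 0 ≤ s → 0 ≤ r → a ∈ Icc (-1 : ℝ) 1 → b ∈ Icc (-1 : ℝ) 1 →
    (∀ x ∈ X, x - p ≤ κ + s * max (x - a) 0 + r * max (x - b) 0) →
    W ≤ κ + s * tail M₀ M₁ a a + r * tail M₀ M₁ b b

/-- Means above the support of the distribution can be ignored in the dual bound. -/
lemma dualBound_ignore (h : TailData M₀ M₁) {X : Set ℝ} {p W : ℝ} (hX : X ⊆ Icc (-1) 1)
    (hp : -1 ≤ p) (hA : DualBound M₀ M₁ X p W) {κ s a : ℝ} (hκ : 0 ≤ κ) (hs : 0 ≤ s)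
    (ha : a ∈ Icc (-1 : ℝ) 1)
    (hle : ∀ x ∈ X, M₀ x < 1 → x - p ≤ κ + s * max (x - a) 0) :
    W ≤ κ + s * tail M₀ M₁ a a := by
  -- Here z is the top of the support. A further kink at b just below z, of slope 2 / (z − b), is
  -- worth at least 2 ≥ x − p from z on, yet costs at most 2 (1 − M₀ b). As b tends to z this falls
  -- below any supposed violation of the bound.
  have hcomp : IsCompact (Icc (-1 : ℝ) 1 ∩ M₀ ⁻¹' {1}) :=
    isCompact_Icc.inter_right (isClosed_singleton.preimage h.cont₀)
  obtain ⟨z, hz, hzl⟩ := hcomp.exists_isLeast ⟨1, by simp [h.one]⟩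
  have hMz : M₀ z = 1 := hz.2
  have hz1 : -1 < z := by
    refine lt_of_le_of_ne hz.1.1 fun hcon => ?_
    rw [← hcon, h.zero] at hMz
    norm_num at hMz
  by_contra! hcon
  have hev : ∀ᶠ t in nhdsWithin z (Iio z),
      1 - (W - (κ + s * tail M₀ M₁ a a)) / 2 < M₀ t := by
    refine (h.cont₀.continuousAt.eventually_const_lt ?_).filter_mono nhdsWithin_le_nhds
    rw [hMz]
    linarith
  have hev2 : ∀ᶠ t in nhdsWithin z (Iio z), t ∈ Ioo (-1) z := Ioo_mem_nhdsLT hz1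
  obtain ⟨b, hb, hb2⟩ := (hev.and hev2).exists
  have hzb : 0 < z - b := by linarith [hb2.2]
  have hW := hA κ s (2 / (z - b)) a b hκ hs (by positivity) ha
    ⟨hb2.1.le, by linarith [hb2.2, hz.1.2]⟩ (by
      intro x hx
      by_cases hMx : M₀ x < 1
      · have := hle x hx hMx
        have h2 : 0 ≤ 2 / (z - b) * max (x - b) 0 := by positivity
        linarith
      · have hMx1 : M₀ x = 1 :=
          le_antisymm (h.one ▸ h.mono (hX hx).2) (not_lt.1 hMx)
        have hzx : z ≤ x := hzl ⟨hX hx, hMx1⟩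
        have h2 : 2 ≤ 2 / (z - b) * max (x - b) 0 := by
          calc (2 : ℝ) = 2 / (z - b) * (z - b) := by field_simp
            _ ≤ 2 / (z - b) * max (x - b) 0 := by
              gcongr
              exact le_max_of_le_left (by linarith)
        have h3 : 0 ≤ s * max (x - a) 0 := by positivity
        linarith [(hX hx).2])
  have hT : tail M₀ M₁ b b ≤ (z - b) * (1 - M₀ b) := by
    have h1 := h.upper hb2.2.le
    have h2 := h.moment_eq_of_mass_eq (hMz.trans h.one.symm)
    rw [hMz, h2] at h1
    unfold tail
    linarith
  have h3 : 2 / (z - b) * tail M₀ M₁ b b ≤ 2 * (1 - M₀ b) := by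
    calc _ ≤ 2 / (z - b) * ((z - b) * (1 - M₀ b)) := by gcongr
      _ = 2 * (1 - M₀ b) := by field_simp
  linarith

/-- Cells `[a, b₁) ∪ [b₂, 1]` and `[b₁, b₂)` with conditional means `x₁` and `x₂`. -/
structure BiPool (M₀ M₁ : ℝ → ℝ) (a b₁ b₂ x₁ x₂ : ℝ) : Prop where
  lower : -1 ≤ a
  le₁ : a ≤ b₁
  le₂ : b₁ ≤ b₂
  upper : b₂ ≤ 1
  outer : (M₁ b₁ - M₁ a) + (M₁ 1 - M₁ b₂) = x₁ * ((M₀ b₁ - M₀ a) + (1 - M₀ b₂))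
  inner : M₁ b₂ - M₁ b₁ = x₂ * (M₀ b₂ - M₀ b₁)

/-- Taking b₁ = b₂ = 1 empties the inner cell, so its nominal mean is free and may repeat x. -/
lemma biPool_of_tail_eq_zero (h : TailData M₀ M₁) {a x : ℝ} (ha : a ∈ Icc (-1 : ℝ) 1)
    (hx : tail M₀ M₁ x a = 0) : BiPool M₀ M₁ a 1 1 x x where
  lower := ha.1
  le₁ := ha.2
  le₂ := le_rfl
  upper := le_rfl
  outer := by
    unfold tail at hx
    rw [h.one]
    linarith
  inner := by simp

/-- A vanishing tail integral means that the states above b have mean z, so tails at any other price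
follow from the mass alone. -/
lemma tail_self (z b : ℝ) (hz : tail M₀ M₁ z b = 0) (p : ℝ) :
    tail M₀ M₁ p b = (z - p) * (1 - M₀ b) := by
  unfold tail at *
  linarith

end TailData

/-! ### Construction of the bi-pool, case by case -/

section

namespace TailData

variable {M₀ M₁ : ℝ → ℝ}

/-- All admissible means are at most `y`, and the pool above the price `p` has a larger mean: the
threshold is lowered until the pool has mean `y`. -/
lemma exists_pool_below (h : TailData M₀ M₁) {X : Set ℝ} (hX : X ⊆ Icc (-1) 1) {p W y : ℝ}
    (hp : p ∈ Icc (-1 : ℝ) 1) (hW : 0 < W) (hA : DualBound M₀ M₁ X p W)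
    (hB : tail M₀ M₁ p (-1) ≤ W) (hpy : p ≤ y) (hyp : 0 ≤ tail M₀ M₁ y p)
    (hle : ∀ x ∈ X, M₀ x < 1 → x ≤ y) :
    ∃ a ∈ Icc (-1 : ℝ) 1, tail M₀ M₁ y a = 0 ∧ W ≤ tail M₀ M₁ p a := by
  have hneg : tail M₀ M₁ y (-1) ≤ 0 := by
    by_contra! hcon
    -- The constant majorant y − p: if the overall mean exceeded y, then W ≤ y − p would be less
    -- than the value of always proposing.
    have h1 := h.dualBound_ignore hX hp.1 hA (κ := y - p) (s := 0) (a := p) (by linarith) le_rfl hp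
      (fun x hx hx1 => by linarith [hle x hx hx1])
    unfold tail at hcon hB
    rw [h.zero] at hcon hB
    linarith
  obtain ⟨a, ha, ha0⟩ := intermediate_value_Icc hp.1 (h.continuous_tail y).continuousOn
    (show (0 : ℝ) ∈ Icc _ _ from ⟨hneg, hyp⟩)
  have ha1 : a ∈ Icc (-1 : ℝ) 1 := ⟨ha.1, ha.2.trans hp.2⟩
  refine ⟨a, ha1, ha0, ?_⟩
  rcases (ha.2.trans hpy).lt_or_eq with hay | hay
  · have hya : 0 < y - a := by linarith
    -- Slope of the line from (a, 0) to (y, y − p). As a ≤ p it is at most 1, so the line stays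
    -- above x − p to the left of y; its integral over [a, 1] is the value of the pool.
    have hs : 0 ≤ (y - p) / (y - a) := div_nonneg (by linarith) hya.le
    have hs1 : (y - p) / (y - a) ≤ 1 := (div_le_one hya).2 (by linarith [ha.2])
    have hsy : (y - p) / (y - a) * (y - a) = y - p := by field_simp
    have h1 := h.dualBound_ignore hX hp.1 hA (κ := 0) le_rfl hs ha1 (fun x hx hx1 => by
      have h2 := hle x hx hx1
      have h3 : (y - p) / (y - a) * (x - a) ≤ (y - p) / (y - a) * max (x - a) 0 :=
        mul_le_mul_of_nonneg_left (le_max_left _ _) hs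
      have h4 : (y - p) / (y - a) * (y - x) ≤ 1 * (y - x) :=
        mul_le_mul_of_nonneg_right hs1 (by linarith)
      linarith)
    rw [tail_self y a ha0 a, ← mul_assoc, hsy, zero_add] at h1
    rwa [tail_self y a ha0 p]
  · have hyp' : y = p := le_antisymm (hay ▸ ha.2) hpy
    have h1 := h.dualBound_ignore hX hp.1 hA (κ := 0) (s := 0) (a := p) le_rfl le_rfl hp
      (fun x hx hx1 => by linarith [hle x hx hx1])
    linarith

/-- The positive part of x − p is a majorant for every X: this is the value without any constraint
on the means. -/
lemma le_tail_price {X : Set ℝ} {p W : ℝ} (hA : DualBound M₀ M₁ X p W) (hp : p ∈ Icc (-1 : ℝ) 1) :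
    W ≤ tail M₀ M₁ p p := by
  have := hA 0 1 0 p p le_rfl zero_le_one le_rfl hp hp (fun x _ => by
    have := le_max_left (x - p) 0
    linarith)
  linarith

/-- If `z` is the smallest admissible mean above the price `p`, then no plan is better than the pool
with mean `z`. -/
lemma exists_pool_above {X : Set ℝ} {p W z b : ℝ}
    (hA : DualBound M₀ M₁ X p W) (hb : b ∈ Icc (-1 : ℝ) 1) (hpb : p ≤ b) (hbz : b < z)
    (hb0 : tail M₀ M₁ z b = 0) (hle : ∀ x ∈ X, p ≤ x → z ≤ x) :
    W ≤ tail M₀ M₁ p b := by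
  have hzb : 0 < z - b := by linarith
  -- The line from (b, 0) to (z, z − p) has slope at least 1 because p ≤ b, so it dominates x − p
  -- beyond z; between p and z there is no admissible mean to check.
  have hs1 : 1 ≤ (z - p) / (z - b) := (one_le_div hzb).2 (by linarith)
  have hsz : (z - p) / (z - b) * (z - b) = z - p := by field_simp
  have h1 := hA 0 ((z - p) / (z - b)) 0 b b le_rfl (by linarith) le_rfl hb hb (fun x hx => by
    have h3 : (z - p) / (z - b) * (x - b) ≤ (z - p) / (z - b) * max (x - b) 0 :=
      mul_le_mul_of_nonneg_left (le_max_left _ _) (by linarith)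
    have h3' : 0 ≤ (z - p) / (z - b) * max (x - b) 0 := by positivity
    by_cases hpx : p ≤ x
    · have h2 := hle x hx hpx
      have h4 : 1 * (x - z) ≤ (z - p) / (z - b) * (x - z) :=
        mul_le_mul_of_nonneg_right hs1 (by linarith)
      linarith
    · linarith)
  rw [tail_self z b hb0 b, ← mul_assoc, hsz, zero_mul, zero_add, add_zero] at h1
  rwa [tail_self z b hb0 p]

/-- The optimal unconstrained pool can be split into pools with means `y` and `z`. -/
lemma exists_biPool_split (h : TailData M₀ M₁) {p y z b : ℝ} (hp : p ∈ Icc (-1 : ℝ) 1)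
    (hpb : p ≤ b) (hyz : y < z) (hy : 0 < tail M₀ M₁ y p)
    (hz : tail M₀ M₁ z p < 0) (hb0 : tail M₀ M₁ z b = 0)
    (hyb : tail M₀ M₁ y p ≤ tail M₀ M₁ y b) :
    ∃ b₁ b₂, BiPool M₀ M₁ p b₁ b₂ y z := by
  have hzy : 0 < z - y := by linarith
  -- The mass that a pool of mean z must have for the rest of [p, 1] to have mean y.
  set m := tail M₀ M₁ y p / (z - y) with hm
  have hmz : m * (z - y) = tail M₀ M₁ y p := by rw [hm]; field_simp
  have hm0 : 0 < m := div_pos hy hzy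
  have hmb : m ≤ 1 - M₀ b := by
    rw [hm, div_le_iff₀ hzy, mul_comm, ← tail_self z b hb0 y]
    exact hyb
  have hmp : m ≤ 1 - M₀ p := hmb.trans (by linarith [h.mono hpb])
  obtain ⟨b₁, b₂, h1, h2, h3, h4, h5⟩ := h.exists_window (z := z) hp hm0 hmp (by
    intro q hq hqm
    rcases le_total q z with hqz | hqz
    · have := h.upper hq.1
      have h6 : q * (M₀ q - M₀ p) ≤ z * (M₀ q - M₀ p) :=
        mul_le_mul_of_nonneg_right hqz (by linarith)
      rw [hqm] at this h6
      linarith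
    · have := h.tail_nonneg hq.2 hqz
      unfold tail at this hz
      rw [hqm] at this
      linarith) (by
    intro q hq hqm
    -- Since m ≤ 1 − M₀ b, the highest window starts no lower than b, up to a null interval, and
    -- upper tails starting there have mean at least z.
    have : 0 ≤ tail M₀ M₁ z q := by
      rcases le_total q z with hqz | hqz
      · rcases le_total b q with hbq | hbq
        · rw [← hb0]
          exact h.tail_le_of_le hbq hqz
        · have hM : M₀ q = M₀ b := le_antisymm (h.mono hbq) (by linarith)
          have : tail M₀ M₁ z q = tail M₀ M₁ z b := by
            unfold tail
            rw [hM, h.moment_eq_of_mass_eq hM]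
          rw [this, hb0]
      · exact h.tail_nonneg hq.2 hqz
    unfold tail at this
    rw [hqm] at this
    linarith)
  refine ⟨b₁, b₂, hp.1, h1, h2, h3, ?_, ?_⟩
  · unfold tail at hmz
    have e1 : M₁ b₁ - M₁ p + (M₁ 1 - M₁ b₂) = M₁ 1 - M₁ p - z * m := by linarith
    have e2 : M₀ b₁ - M₀ p + (1 - M₀ b₂) = 1 - M₀ p - m := by linarith
    rw [e1, e2]
    linarith
  · rw [h5, h4]

/-- The optimal unconstrained pool cannot be split: the threshold is lowered until the pools
`[a, b)` and `[b, 1]` have means `y` and `z`. -/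
lemma exists_biPool_lower (h : TailData M₀ M₁) {X : Set ℝ} {p W y z b : ℝ}
    (hp : p ∈ Icc (-1 : ℝ) 1) (hA : DualBound M₀ M₁ X p W)
    (hB : tail M₀ M₁ p (-1) ≤ W) (hpy : p ≤ y)
    (hpb : p ≤ b) (hb1 : b ≤ 1) (hbz : b < z) (hb0 : tail M₀ M₁ z b = 0)
    (hyb : tail M₀ M₁ y b < tail M₀ M₁ y p)
    (hle : ∀ x ∈ X, p ≤ x → x ≤ y ∨ z ≤ x) :
    ∃ a, BiPool M₀ M₁ a b 1 y z ∧ W ≤ tail M₀ M₁ p a := by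
  have hby : y < b := by
    by_contra! hcon
    exact absurd (h.tail_le_of_le hpb hcon) (not_le.2 hyb)
  have hzb : 0 < z - b := by linarith
  have hbI : b ∈ Icc (-1 : ℝ) 1 := ⟨hp.1.trans hpb, hb1⟩
  have hneg : tail M₀ M₁ y (-1) ≤ tail M₀ M₁ y b := by
    by_contra! hcon
    have hr : 0 ≤ (z - y) / (z - b) := div_nonneg (by linarith) hzb.le
    have hr1 : 1 ≤ (z - y) / (z - b) := (one_le_div hzb).2 (by linarith)
    have hrz : (z - y) / (z - b) * (z - b) = z - y := by field_simp
    -- The majorant is y − p up to b and then rises through (z, z − p). If even the threshold −1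
    -- left the mean below b above y, its integral would be less than the value of always proposing.
    have h1 := hA (y - p) 0 ((z - y) / (z - b)) b b (by linarith) le_rfl hr hbI hbI (fun x hx => by
      have h3 : (z - y) / (z - b) * (x - b) ≤ (z - y) / (z - b) * max (x - b) 0 :=
        mul_le_mul_of_nonneg_left (le_max_left _ _) hr
      have h3' : 0 ≤ (z - y) / (z - b) * max (x - b) 0 := by positivity
      rcases le_total p x with hpx | hpx
      · rcases hle x hx hpx with h2 | h2
        · linarith
        · have h4 : 1 * (x - z) ≤ (z - y) / (z - b) * (x - z) :=
            mul_le_mul_of_nonneg_right hr1 (by linarith)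
          linarith
      · linarith)
    rw [zero_mul, add_zero, tail_self z b hb0 b, ← mul_assoc, hrz] at h1
    unfold tail at hcon hB hb0
    rw [h.zero] at hcon hB
    linarith
  -- Equal tail integrals at a and b say that [a, b) has mean y.
  obtain ⟨a, ha, ha0⟩ := intermediate_value_Icc hp.1 (h.continuous_tail y).continuousOn
    (show tail M₀ M₁ y b ∈ Icc _ _ from ⟨hneg, hyb.le⟩)
  have ha1 : a ∈ Icc (-1 : ℝ) 1 := ⟨ha.1, ha.2.trans hp.2⟩
  refine ⟨a, ⟨ha.1, ha.2.trans hpb, hb1, le_rfl, ?_, ?_⟩, ?_⟩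
  · unfold tail at ha0
    rw [h.one]
    linarith
  · unfold tail at hb0
    rw [h.one]
    linarith
  have hay : a < y := by
    refine lt_of_le_of_ne (ha.2.trans hpy) fun hcon => ?_
    have hap : a = p := le_antisymm ha.2 (hcon ▸ hpy)
    rw [hap] at ha0
    linarith
  have hya : 0 < y - a := by linarith
  -- The majorant vanishes up to a, has slope s up to b and s + r afterwards, with s and r chosen so
  -- that it passes through (y, y − p) and (z, z − p). It is affine on each pool, so its integral is
  -- exactly the value of the plan. From a ≤ p comes s ≤ 1, and then y < b gives s + r ≥ 1; these
  -- put it above x − p on X.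
  set s := (y - p) / (y - a) with hs_def
  have hs : 0 ≤ s := div_nonneg (by linarith) hya.le
  have hs1 : s ≤ 1 := (div_le_one hya).2 (by linarith [ha.2])
  have hsy : s * (y - a) = y - p := by rw [hs_def]; field_simp
  set r := (z - p - s * (z - a)) / (z - b) with hr_def
  have hrz : r * (z - b) = z - p - s * (z - a) := by rw [hr_def]; field_simp
  have hsb : s * (b - y) ≤ 1 * (b - y) := mul_le_mul_of_nonneg_right hs1 (by linarith)
  have hsr : 1 ≤ s + r := by
    have : 1 * (z - b) ≤ (s + r) * (z - b) := by linarith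
    exact le_of_mul_le_mul_right this hzb
  have hr : 0 ≤ r := by linarith
  have h1 := hA 0 s r a b le_rfl hs hr ha1 hbI (fun x hx => by
    have h3 : s * (x - a) ≤ s * max (x - a) 0 :=
      mul_le_mul_of_nonneg_left (le_max_left _ _) hs
    have h4 : r * (x - b) ≤ r * max (x - b) 0 :=
      mul_le_mul_of_nonneg_left (le_max_left _ _) hr
    have h3' : 0 ≤ s * max (x - a) 0 := by positivity
    have h4' : 0 ≤ r * max (x - b) 0 := by positivity
    rcases le_total p x with hpx | hpx
    · rcases hle x hx hpx with h2 | h2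
      · have h5 : s * (y - x) ≤ 1 * (y - x) := mul_le_mul_of_nonneg_right hs1 (by linarith)
        linarith
      · have h5 : 1 * (x - z) ≤ (s + r) * (x - z) := mul_le_mul_of_nonneg_right hsr (by linarith)
        linarith
    · linarith)
  rw [tail_self z b hb0 b, ← mul_assoc, hrz] at h1
  have e1 : s * tail M₀ M₁ a a = s * (y - a) * (1 - M₀ a) + s * (tail M₀ M₁ y b) := by
    rw [← ha0]
    unfold tail
    ring
  rw [e1, hsy, tail_self z b hb0 y] at h1
  have e2 : tail M₀ M₁ p a = (y - p) * (1 - M₀ a) + (z - y) * (1 - M₀ b) := by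
    rw [← tail_self z b hb0 y, ← ha0]
    unfold tail
    ring
  rw [e2]
  have e3 : s * (y - a) * (1 - M₀ b) = (y - p) * (1 - M₀ b) := by rw [hsy]
  linarith

/-- **Bi-pooling.** Every value that satisfies the dual bounds and exceeds that of pooling
everything is surpassed by a threshold partition with at most two pools with admissible means. -/
theorem exists_biPool (h : TailData M₀ M₁) {X : Set ℝ} (hXc : IsCompact X)
    (hX : X ⊆ Icc (-1) 1) {p W : ℝ} (hp : -1 ≤ p) (hW : 0 < W) (hA : DualBound M₀ M₁ X p W)
    (hB : tail M₀ M₁ p (-1) ≤ W) :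
    ∃ a b₁ b₂, ∃ x₁ ∈ X, ∃ x₂ ∈ X, p ≤ x₁ ∧ p ≤ x₂ ∧ BiPool M₀ M₁ a b₁ b₂ x₁ x₂ ∧
      W ≤ tail M₀ M₁ p a := by
  have hp1 : p ≤ 1 := by
    by_contra! hcon
    have := hA 0 0 0 0 0 le_rfl le_rfl le_rfl (by norm_num) (by norm_num)
      (fun x hx => by linarith [(hX hx).2])
    linarith
  have hpI : p ∈ Icc (-1 : ℝ) 1 := ⟨hp, hp1⟩
  have hWp : W ≤ tail M₀ M₁ p p := le_tail_price hA hpI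
  have hMp : M₀ p < 1 := by
    by_contra! hcon
    have h1 : M₀ p = M₀ 1 := le_antisymm (h.mono hp1) (by rw [h.one]; exact hcon)
    have h2 := h.moment_eq_of_mass_eq h1
    unfold tail at hWp
    rw [h2, h1, h.one] at hWp
    linarith
  -- The sign of `tail M₀ M₁ x p` tells on which side of x the mean of the states above p lies.
  have hmono : ∀ {x x'}, tail M₀ M₁ x p ≤ 0 → 0 ≤ tail M₀ M₁ x' p → x' ≤ x := by
    intro x x' hx hx'
    have : 0 ≤ (x - x') * (1 - M₀ p) := by
      unfold tail at hx hx'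
      linarith
    nlinarith
  have single : ∀ {x a}, x ∈ X → p ≤ x → a ∈ Icc (-1 : ℝ) 1 → tail M₀ M₁ x a = 0 →
      W ≤ tail M₀ M₁ p a → ∃ a b₁ b₂, ∃ x₁ ∈ X, ∃ x₂ ∈ X, p ≤ x₁ ∧ p ≤ x₂ ∧
        BiPool M₀ M₁ a b₁ b₂ x₁ x₂ ∧ W ≤ tail M₀ M₁ p a :=
    fun {x a} hx hpx ha h0 hWa =>
      ⟨a, 1, 1, x, hx, x, hx, hpx, hpx, h.biPool_of_tail_eq_zero ha h0, hWa⟩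
  have hcont : Continuous fun x => tail M₀ M₁ x p := by
    unfold tail
    fun_prop
  have hYc : IsCompact (X ∩ (Ici p ∩ (fun x => tail M₀ M₁ x p) ⁻¹' Ici 0)) :=
    hXc.inter_right (isClosed_Ici.inter (isClosed_Ici.preimage hcont))
  have hZc : IsCompact (X ∩ (Ici p ∩ (fun x => tail M₀ M₁ x p) ⁻¹' Iic 0)) :=
    hXc.inter_right (isClosed_Ici.inter (isClosed_Iic.preimage hcont))
  -- The condition `M₀ x < 1` keeps x below the top of the support, so that x can be the mean of an
  -- upper tail of positive mass.
  by_cases hZ : ∃ x ∈ X, p ≤ x ∧ tail M₀ M₁ x p ≤ 0 ∧ M₀ x < 1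
  · obtain ⟨x, hx, hpx, hx0, hx1⟩ := hZ
    obtain ⟨z, ⟨hzX, hpz, hz0⟩, hzl⟩ := hZc.exists_isLeast ⟨x, hx, hpx, hx0⟩
    have hz0' : tail M₀ M₁ z p ≤ 0 := hz0
    have hpz' : p ≤ z := hpz
    have hMz : M₀ z < 1 := (h.mono (hzl ⟨hx, hpx, hx0⟩)).trans_lt hx1
    have hzz := h.tail_pos hMz
    obtain ⟨b, hb, hb0⟩ := intermediate_value_Icc hpz' (h.continuous_tail z).continuousOn
      (show (0 : ℝ) ∈ Icc _ _ from ⟨hz0', hzz.le⟩)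
    have hbz : b < z := by
      refine lt_of_le_of_ne hb.2 fun hcon => ?_
      rw [hcon] at hb0
      linarith
    have hbI : b ∈ Icc (-1 : ℝ) 1 := ⟨hp.trans hb.1, hbz.le.trans (hX hzX).2⟩
    rcases hz0'.lt_or_eq with hzlt | hzeq
    swap
    · exact single hzX hpz' hpI hzeq hWp
    by_cases hY : (X ∩ (Ici p ∩ (fun x => tail M₀ M₁ x p) ⁻¹' Ici 0)).Nonempty
    · obtain ⟨y, ⟨hyX, hpy, hy0⟩, hyg⟩ := hYc.exists_isGreatest hY
      have hy0' : 0 ≤ tail M₀ M₁ y p := hy0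
      have hyz : y < z := by
        refine lt_of_le_of_ne (hmono hz0' hy0') fun hcon => ?_
        rw [hcon] at hy0'
        linarith
      rcases hy0'.lt_or_eq with hylt | hyeq
      swap
      · exact single hyX hpy hpI hyeq.symm hWp
      by_cases hyb : tail M₀ M₁ y p ≤ tail M₀ M₁ y b
      · obtain ⟨b₁, b₂, hpool⟩ :=
          h.exists_biPool_split hpI hb.1 hyz hylt hzlt hb0 hyb
        exact ⟨p, b₁, b₂, y, hyX, z, hzX, hpy, hpz', hpool, hWp⟩
      · obtain ⟨a, hpool, hWa⟩ := h.exists_biPool_lower hpI hA hB hpy hb.1 hbI.2 hbz hb0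
          (not_le.1 hyb) (fun x hx hpx => by
            rcases le_total 0 (tail M₀ M₁ x p) with h0 | h0
            · exact Or.inl (hyg ⟨hx, hpx, h0⟩)
            · exact Or.inr (hzl ⟨hx, hpx, h0⟩))
        exact ⟨a, b, 1, y, hyX, z, hzX, hpy, hpz', hpool, hWa⟩
    · refine single hzX hpz' hbI hb0 (exists_pool_above hA hbI hb.1 hbz hb0 fun x hx hpx => ?_)
      rcases le_total 0 (tail M₀ M₁ x p) with h0 | h0
      · exact absurd ⟨x, hx, hpx, h0⟩ hY
      · exact hzl ⟨hx, hpx, h0⟩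
  · push Not at hZ
    have halive : ∀ x ∈ X, M₀ x < 1 → p ≤ x → 0 ≤ tail M₀ M₁ x p := by
      intro x hx hx1 hpx
      by_contra! hcon
      exact absurd (hZ x hx hpx hcon.le) (not_le.2 hx1)
    by_cases hY : (X ∩ (Ici p ∩ (fun x => tail M₀ M₁ x p) ⁻¹' Ici 0)).Nonempty
    · obtain ⟨y, ⟨hyX, hpy, hy0⟩, hyg⟩ := hYc.exists_isGreatest hY
      have hpy' : p ≤ y := hpy
      obtain ⟨a, ha, ha0, hWa⟩ := h.exists_pool_below hX hpI hW hA hB hpy hy0 (fun x hx hx1 => by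
        rcases le_total p x with hpx | hpx
        · exact hyg ⟨hx, hpx, halive x hx hx1 hpx⟩
        · linarith)
      exact single hyX hpy ha ha0 hWa
    · have := h.dualBound_ignore hX hp hA (κ := 0) (s := 0) (a := p) le_rfl le_rfl hpI
        (fun x hx hx1 => by
          by_contra! hcon
          have hpx : p ≤ x := by linarith
          exact hY ⟨x, hx, hpx, halive x hx hx1 hpx⟩)
      linarith

end TailData

end

/-! ### Masses and moments of the prior F -/

section

/-- The states below `b`. -/
def below (b : ℝ) : Set State := {θ | (θ : ℝ) < b}

lemma measurableSet_below (b : ℝ) : MeasurableSet (below b) :=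
  measurableSet_lt measurable_subtype_coe measurable_const

/-- The probability of the states below `b`. -/
def mass (F : Measure State) (b : ℝ) : ℝ := F.real (below b)

/-- The partial first moment of the states below `b`. -/
def moment (F : Measure State) (b : ℝ) : ℝ := ∫ θ in below b, (θ : ℝ) ∂F

lemma measurable_state : Measurable fun θ : State => (θ : ℝ) := measurable_subtype_coe

lemma integrable_of_abs_le {X : Type*} [MeasurableSpace X] {μ : Measure X} [IsFiniteMeasure μ]
    {f : X → ℝ} (hf : Measurable f) {C : ℝ} (hC : ∀ x, |f x| ≤ C) : Integrable f μ :=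
  Integrable.of_bound hf.aestronglyMeasurable C (Filter.Eventually.of_forall hC)

lemma abs_state_le (θ : State) : |(θ : ℝ)| ≤ 1 := abs_le.2 θ.2

lemma integrable_state (F : Measure State) [IsFiniteMeasure F] :
    Integrable (fun θ : State => (θ : ℝ)) F :=
  integrable_of_abs_le measurable_state abs_state_le

lemma mass_eq_integral (F : Measure State) (b : ℝ) :
    mass F b = ∫ _θ in below b, (1 : ℝ) ∂F := by
  simp [mass]

variable {F : Measure State}

/-- Dominated convergence: as the endpoint tends to b, the indicators converge except at the state
b, which is null because F has no atoms. -/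
lemma continuous_integral_below [IsFiniteMeasure F] (hF : ∀ θ, F {θ} = 0) {f : State → ℝ}
    (hf : Integrable f F) :
    Continuous fun b => ∫ θ in below b, f θ ∂F := by
  have : (fun b => ∫ θ in below b, f θ ∂F) = fun b => ∫ θ, (below b).indicator f θ ∂F := by
    funext b
    rw [integral_indicator (measurableSet_below b)]
  rw [this, continuous_iff_continuousAt]
  intro b
  refine continuousAt_of_dominated (bound := fun θ => ‖f θ‖) ?_ ?_ hf.norm ?_
  · exact Filter.Eventually.of_forall fun b' =>
      hf.aestronglyMeasurable.indicator (measurableSet_below b')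
  · exact Filter.Eventually.of_forall fun b' => Filter.Eventually.of_forall fun θ =>
      norm_indicator_le_norm_self _ _
  · have hne : ∀ᵐ θ : State ∂F, (θ : ℝ) ≠ b := by
      by_cases hb : b ∈ Icc (-1 : ℝ) 1
      · have h0 : ∀ᵐ θ : State ∂F, θ ≠ ⟨b, hb⟩ := by
          rw [ae_iff]
          simpa using hF ⟨b, hb⟩
        filter_upwards [h0] with θ hθ h1
        exact hθ (Subtype.ext h1)
      · exact Filter.Eventually.of_forall fun θ h1 => hb (h1 ▸ θ.2)
    filter_upwards [hne] with θ hθ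
    rcases hθ.lt_or_gt with h1 | h1
    · refine (continuousAt_const (y := f θ)).congr ?_
      filter_upwards [lt_mem_nhds h1] with b' hb'
      exact (indicator_of_mem (show θ ∈ below b' from hb') f).symm
    · refine (continuousAt_const (y := 0)).congr ?_
      filter_upwards [gt_mem_nhds h1] with b' hb'
      exact (indicator_of_notMem (show θ ∉ below b' from not_lt.2 hb'.le) f).symm

lemma integral_below_sub [IsFiniteMeasure F] {f : State → ℝ} (hf : Integrable f F) {a b : ℝ}
    (hab : a ≤ b) : (∫ θ in below b, f θ ∂F) - ∫ θ in below a, f θ ∂F =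
      ∫ θ in below b \ below a, f θ ∂F := by
  rw [setIntegral_sdiff (measurableSet_below a) hf.integrableOn]
  exact fun θ (hθ : (θ : ℝ) < a) => hθ.trans_le hab

lemma mass_sub [IsFiniteMeasure F] {a b : ℝ} (hab : a ≤ b) :
    mass F b - mass F a = F.real (below b \ below a) := by
  rw [mass_eq_integral, mass_eq_integral, integral_below_sub (integrable_const _) hab]
  simp

lemma measure_compl_below_one (hF : ∀ θ, F {θ} = 0) : F (below 1)ᶜ = 0 := by
  refine measure_mono_null ?_ (hF ⟨1, by norm_num⟩)
  intro θ hθ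
  exact Subtype.ext (le_antisymm θ.2.2 (not_lt.1 hθ))

lemma integral_below_one (hF : ∀ θ, F {θ} = 0) (f : State → ℝ) :
    ∫ θ in below 1, f θ ∂F = ∫ θ, f θ ∂F := by
  rw [← setIntegral_univ (μ := F) (f := f)]
  refine setIntegral_congr_set ?_
  rw [ae_eq_univ]
  exact measure_compl_below_one hF

lemma tailData [IsProbabilityMeasure F] (hF : ∀ θ, F {θ} = 0) :
    TailData (mass F) (moment F) where
  cont₀ := by
    have := continuous_integral_below hF (integrable_const (μ := F) (1 : ℝ))
    simpa only [← mass_eq_integral] using this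
  cont₁ := continuous_integral_below hF (integrable_state F)
  mono := fun a b hab => by
    have := mass_sub (F := F) hab
    have h2 : 0 ≤ F.real (below b \ below a) := measureReal_nonneg
    linarith
  lower := fun {a b} hab => by
    rw [mass_sub hab, moment, moment, integral_below_sub (integrable_state F) hab, mul_comm,
      ← smul_eq_mul, ← setIntegral_const]
    refine setIntegral_mono_on (integrable_const _).integrableOn
      (integrable_state F).integrableOn ((measurableSet_below b).diff (measurableSet_below a)) ?_
    exact fun θ hθ => not_lt.1 hθ.2
  upper := fun {a b} hab => by
    rw [mass_sub hab, moment, moment, integral_below_sub (integrable_state F) hab, mul_comm b,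
      ← smul_eq_mul, ← setIntegral_const]
    refine setIntegral_mono_on (integrable_state F).integrableOn
      (integrable_const _).integrableOn ((measurableSet_below b).diff (measurableSet_below a)) ?_
    exact fun θ hθ => le_of_lt hθ.1
  zero := by
    have : below (-1) = ∅ := eq_empty_of_forall_notMem fun θ hθ => not_lt.2 θ.2.1 hθ
    simp [mass, this]
  one := by
    rw [mass_eq_integral, integral_below_one hF]
    simp

lemma integral_compl_below [IsFiniteMeasure F] (hF : ∀ θ, F {θ} = 0) {f : State → ℝ}
    (hf : Integrable f F) (b : ℝ) :
    ∫ θ in (below b)ᶜ, f θ ∂F = (∫ θ in below 1, f θ ∂F) - ∫ θ in below b, f θ ∂F := by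
  rw [integral_below_one hF, ← integral_add_compl (measurableSet_below b) hf]
  ring

lemma tail_eq_integral [IsProbabilityMeasure F] (hF : ∀ θ, F {θ} = 0) (z b : ℝ) :
    tail (mass F) (moment F) z b = ∫ θ in (below b)ᶜ, ((θ : ℝ) - z) ∂F := by
  rw [integral_sub (integrable_state F).integrableOn (integrable_const _).integrableOn,
    integral_compl_below hF (integrable_state F), integral_compl_below hF (integrable_const z),
    tail]
  have h1 : F.real (below 1) = 1 := (tailData hF).one
  simp only [setIntegral_const, smul_eq_mul, mass, moment, h1]
  ring

lemma tail_self_eq_integral [IsProbabilityMeasure F] (hF : ∀ θ, F {θ} = 0) (b : ℝ) :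
    tail (mass F) (moment F) b b = ∫ θ : State, max ((θ : ℝ) - b) 0 ∂F := by
  rw [tail_eq_integral hF, ← integral_indicator (measurableSet_below b).compl]
  refine integral_congr_ae (Filter.Eventually.of_forall fun θ => ?_)
  by_cases h : (θ : ℝ) < b
  · have h1 : θ ∉ (below b)ᶜ := fun h2 => h2 h
    simp only [indicator_of_notMem h1]
    rw [max_eq_right (by linarith)]
  · have h1 : θ ∈ (below b)ᶜ := h
    simp only [indicator_of_mem h1]
    rw [max_eq_left (by linarith)]

lemma moment_neg_one (F : Measure State) : moment F (-1) = 0 := by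
  have : below (-1) = ∅ := eq_empty_of_forall_notMem fun θ hθ => not_lt.2 θ.2.1 hθ
  simp [moment, this]

lemma tail_neg_one [IsProbabilityMeasure F] (hF : ∀ θ, F {θ} = 0) (z : ℝ) :
    tail (mass F) (moment F) z (-1) = (∫ θ : State, (θ : ℝ) ∂F) - z := by
  rw [tail, (tailData hF).zero, moment_neg_one, moment, integral_below_one hF]
  ring

end

/-! ### The voting stage -/

section

variable {n : ℕ}

lemma continuous_atLeast (k : ℕ) : Continuous fun a : Fin n → ℝ => atLeast k a := by
  unfold atLeast
  fun_prop

lemma atLeast_nonneg (k : ℕ) {a : Fin n → ℝ} (ha : ∀ i, a i ∈ Icc (0 : ℝ) 1) :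
    0 ≤ atLeast k a :=
  Finset.sum_nonneg fun _ _ => mul_nonneg (Finset.prod_nonneg fun i _ => (ha i).1)
    (Finset.prod_nonneg fun i _ => sub_nonneg.2 (ha i).2)

lemma atLeast_le_one (k : ℕ) {a : Fin n → ℝ} (ha : ∀ i, a i ∈ Icc (0 : ℝ) 1) :
    atLeast k a ≤ 1 := by
  calc atLeast k a ≤ ∑ A : Finset (Fin n), (∏ i ∈ A, a i) * ∏ i ∈ Aᶜ, (1 - a i) :=
        Finset.sum_le_sum_of_subset_of_nonneg (Finset.filter_subset _ _) fun A _ _ =>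
          mul_nonneg (Finset.prod_nonneg fun i _ => (ha i).1)
            (Finset.prod_nonneg fun i _ => sub_nonneg.2 (ha i).2)
    _ = ∏ i : Fin n, (a i + (1 - a i)) := (Fintype.prod_add _ _).symm
    _ = 1 := by simp

/-- Condition on the set t of other agents who accept. The probability is then affine in agent i's
own, with nonnegative slope because k ≤ |t| implies k ≤ |t| + 1. -/
lemma atLeast_update_mono (k : ℕ) {a : Fin n → ℝ} (ha : ∀ i, a i ∈ Icc (0 : ℝ) 1) (i : Fin n)
    {y y' : ℝ} (hy : y ≤ y') :
    atLeast k (Function.update a i y) ≤ atLeast k (Function.update a i y') := by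
  have key : ∀ x : ℝ, atLeast k (Function.update a i x) =
      ∑ t ∈ (Finset.univ.erase i).powerset, ((∏ j ∈ t, a j) * ∏ j ∈ tᶜ.erase i, (1 - a j)) *
        ((if k ≤ t.card then 1 - x else 0) + (if k ≤ t.card + 1 then x else 0)) := by
    intro x
    have hu : (Finset.univ : Finset (Finset (Fin n))) =
        (insert i (Finset.univ.erase i)).powerset := by
      rw [Finset.insert_erase (Finset.mem_univ i), Finset.powerset_univ]
    rw [atLeast, Finset.sum_filter, hu,
      Finset.sum_powerset_insert (Finset.notMem_erase i _), ← Finset.sum_add_distrib]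
    refine Finset.sum_congr rfl fun t ht => ?_
    have hit : i ∉ t := fun h => Finset.notMem_erase i _ (Finset.mem_powerset.1 ht h)
    have e1 : ∏ j ∈ t, Function.update a i x j = ∏ j ∈ t, a j :=
      Finset.prod_congr rfl fun j hj => Function.update_of_ne (by rintro rfl; exact hit hj) _ _
    have e2 : ∏ j ∈ tᶜ.erase i, (1 - Function.update a i x j) = ∏ j ∈ tᶜ.erase i, (1 - a j) :=
      Finset.prod_congr rfl fun j hj => by
        rw [Function.update_of_ne (Finset.ne_of_mem_erase hj)]
    have e3 : ∏ j ∈ tᶜ, (1 - Function.update a i x j) =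
        (1 - x) * ∏ j ∈ tᶜ.erase i, (1 - a j) := by
      rw [← Finset.mul_prod_erase _ _ (Finset.mem_compl.2 hit), e2, Function.update_self]
    rw [Finset.card_insert_of_notMem hit, Finset.prod_insert hit, Finset.compl_insert, e1, e2, e3,
      Function.update_self]
    split_ifs <;> ring
  rw [key, key]
  refine Finset.sum_le_sum fun t _ => mul_le_mul_of_nonneg_left ?_ ?_
  · split_ifs with h1 h2 h2
    · linarith
    · omega
    · linarith
    · linarith
  · exact mul_nonneg (Finset.prod_nonneg fun i _ => (ha i).1)
      (Finset.prod_nonneg fun i _ => sub_nonneg.2 (ha i).2)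

/-- Actual acceptance probabilities when the rational types vote according to `τ`. -/
def accept (ε : ℝ) (τ : Fin n → ℝ) (i : Fin n) : ℝ := (1 - ε) * τ i + ε / 2

lemma accept_mem {ε : ℝ} (hε : 0 ≤ ε) (hε1 : ε ≤ 1) {τ : Fin n → ℝ}
    (hτ : ∀ i, τ i ∈ Icc (0 : ℝ) 1) (i : Fin n) : accept ε τ i ∈ Icc (0 : ℝ) 1 := by
  have h1 := mul_nonneg (sub_nonneg.2 hε1) (hτ i).1
  have h2 := mul_le_mul_of_nonneg_left (hτ i).2 (sub_nonneg.2 hε1)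
  constructor <;> simp only [accept] <;> linarith

/-- The launch probability when the rational types vote according to `τ`. -/
def launch (k : ℕ) (ε : ℝ) (τ : Fin n → ℝ) : ℝ := atLeast k (accept ε τ)

lemma launch_mem (k : ℕ) {ε : ℝ} (hε : 0 ≤ ε) (hε1 : ε ≤ 1) {τ : Fin n → ℝ}
    (hτ : ∀ i, τ i ∈ Icc (0 : ℝ) 1) : launch k ε τ ∈ Icc (0 : ℝ) 1 :=
  ⟨atLeast_nonneg k (accept_mem hε hε1 hτ), atLeast_le_one k (accept_mem hε hε1 hτ)⟩

/-- Pairs of a posterior mean and a profile of mutually optimal votes of the rational types. -/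
def replies (k : ℕ) (ε : ℝ) (α β : Fin n → ℝ) : Set (ℝ × (Fin n → ℝ)) :=
  {z | z.1 ∈ Icc (-1 : ℝ) 1 ∧ (∀ i, z.2 i ∈ Icc (0 : ℝ) 1) ∧
    ∀ i, ∀ y ∈ Icc (0 : ℝ) 1,
      (α i * z.1 + β i) * atLeast k (Function.update (accept ε z.2) i y) ≤
        (α i * z.1 + β i) * atLeast k (Function.update (accept ε z.2) i (z.2 i))}

lemma continuous_accept (ε : ℝ) : Continuous fun τ : Fin n → ℝ => accept ε τ := by
  unfold accept
  fun_prop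

lemma continuous_launch (k : ℕ) (ε : ℝ) : Continuous fun τ : Fin n → ℝ => launch k ε τ :=
  (continuous_atLeast k).comp (continuous_accept ε)

/-- For each fixed deviation, optimality is a weak inequality between continuous functions, hence a
closed condition on a bounded set. -/
lemma isCompact_replies (k : ℕ) (ε : ℝ) (α β : Fin n → ℝ) : IsCompact (replies k ε α β) := by
  have hc : IsCompact (Icc (-1 : ℝ) 1 ×ˢ Set.univ.pi fun _ : Fin n => Icc (0 : ℝ) 1) :=
    isCompact_Icc.prod (isCompact_univ_pi fun _ => isCompact_Icc)
  refine hc.of_isClosed_subset ?_ fun z hz => ⟨hz.1, fun i _ => hz.2.1 i⟩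
  have hacc : Continuous fun z : ℝ × (Fin n → ℝ) => accept ε z.2 :=
    (continuous_accept ε).comp continuous_snd
  simp only [replies, Set.ofPred_and, Set.ofPred_forall]
  refine IsClosed.inter (isClosed_Icc.preimage continuous_fst) (IsClosed.inter ?_ ?_)
  · exact isClosed_iInter fun i => isClosed_Icc.preimage (by fun_prop)
  · refine isClosed_iInter fun i => isClosed_iInter fun y => isClosed_iInter fun _ => ?_
    refine isClosed_le (Continuous.mul (by fun_prop) ((continuous_atLeast k).comp ?_))
      (Continuous.mul (by fun_prop) ((continuous_atLeast k).comp ?_))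
    · exact hacc.update i continuous_const
    · exact hacc.update i (by fun_prop)

/-- Sincere votes are mutually optimal. -/
lemma exists_reply (k : ℕ) {ε : ℝ} (hε : 0 ≤ ε) (hε1 : ε ≤ 1) (α β : Fin n → ℝ) {x : ℝ}
    (hx : x ∈ Icc (-1 : ℝ) 1) : ∃ τ, (x, τ) ∈ replies k ε α β := by
  classical
  set τ : Fin n → ℝ := fun i => if 0 ≤ α i * x + β i then 1 else 0 with hτ
  have hmem : ∀ i, τ i ∈ Icc (0 : ℝ) 1 := by
    intro i
    simp only [hτ]
    split_ifs <;> simp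
  refine ⟨τ, hx, hmem, fun i y hy => ?_⟩
  have hacc := accept_mem hε hε1 hmem
  by_cases h : 0 ≤ α i * x + β i
  · refine mul_le_mul_of_nonneg_left (atLeast_update_mono k hacc i ?_) h
    simp only [hτ, h, if_true]
    exact hy.2
  · refine mul_le_mul_of_nonpos_left (atLeast_update_mono k hacc i ?_) (not_le.1 h).le
    simp only [hτ, h, if_false]
    exact hy.1

/-- The posterior means at which the launch probability `ℓ` can be implemented. -/
def means (k : ℕ) (ε : ℝ) (α β : Fin n → ℝ) (ℓ : ℝ) : Set ℝ :=
  Prod.fst '' (replies k ε α β ∩ {z | launch k ε z.2 = ℓ})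

/-- Compactness is what lets the bi-pooling argument select the nearest admissible mean on either
side. -/
lemma isCompact_means (k : ℕ) (ε : ℝ) (α β : Fin n → ℝ) (ℓ : ℝ) :
    IsCompact (means k ε α β ℓ) :=
  ((isCompact_replies k ε α β).inter_right
    (isClosed_singleton.preimage ((continuous_launch k ε).comp continuous_snd))).image
    continuous_fst

lemma means_subset (k : ℕ) (ε : ℝ) (α β : Fin n → ℝ) (ℓ : ℝ) :
    means k ε α β ℓ ⊆ Icc (-1) 1 := by
  rintro _ ⟨z, hz, rfl⟩
  exact hz.1.1

end

/-! ### Payoffs as integrals over states, signals and messages -/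

section

section Integrals

variable {n : ℕ} {S M : Type*} [MeasurableSpace S] [MeasurableSpace M]
  {F : Measure State} [IsProbabilityMeasure F]

lemma integral_joint (t : Test S) {h : State → S → ℝ} (hh : Measurable (Function.uncurry h)) {C : ℝ}
    (hC : ∀ θ s, |h θ s| ≤ C) :
    ∫ x, h x.1 x.2 ∂(F ⊗ₘ t.rule) = ∫ θ, ∫ s, h θ s ∂(t.rule θ) ∂F :=
  Measure.integral_compProd (f := fun x : State × S => h x.1 x.2)
    (integrable_of_abs_le hh fun x => hC x.1 x.2)

lemma integral_joint_eq_posterior (t : Test S) {h : State → S → ℝ}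
    (hh : Measurable (Function.uncurry h)) {C : ℝ} (hC : ∀ θ s, |h θ s| ≤ C) :
    ∫ x, h x.1 x.2 ∂(F ⊗ₘ t.rule) = ∫ s, ∫ θ, h θ s ∂(posterior t.rule F s) ∂(F.bind t.rule) := by
  have hh' : Measurable fun y : S × State => h y.2 y.1 := hh.comp measurable_swap
  have h1 := Measure.integral_compProd (μ := F.bind t.rule) (κ := posterior t.rule F)
    (f := fun y : S × State => h y.2 y.1) (integrable_of_abs_le hh' fun x => hC x.2 x.1)
  rw [← h1, compProd_posterior_eq_map_swap,
    integral_map measurable_swap.aemeasurable hh'.aestronglyMeasurable]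
  rfl

lemma integral_joint_fst (t : Test S) {f : State → ℝ} (hf : Measurable f) {C : ℝ}
    (hC : ∀ θ, |f θ| ≤ C) : ∫ x, f x.1 ∂(F ⊗ₘ t.rule) = ∫ θ, f θ ∂F := by
  rw [integral_joint t (h := fun θ _ => f θ) (hf.comp measurable_fst) fun θ _ => hC θ]
  simp

instance (t : Test S) (ρ : Assessment n S M) : IsFiniteMeasure
    ((F ⊗ₘ t.rule).withDensity fun x => ENNReal.ofReal (ρ.propose x.2)) := by
  refine isFiniteMeasure_withDensity_ofReal (Integrable.hasFiniteIntegral ?_)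
  refine integrable_of_abs_le (ρ.measurable_propose.comp measurable_snd) (C := 1) fun x => ?_
  rw [abs_of_nonneg (ρ.propose_mem _).1]
  exact (ρ.propose_mem _).2

instance (t : Test S) (ρ : Assessment n S M) : IsFiniteMeasure (proposalLaw F t ρ) := by
  unfold proposalLaw
  infer_instance

lemma integral_proposalLaw (t : Test S) (ρ : Assessment n S M) {h : M → State → ℝ}
    (hh : Measurable (Function.uncurry h)) {C : ℝ} (hC : ∀ m θ, |h m θ| ≤ C) :
    ∫ y, h y.1 y.2 ∂(proposalLaw F t ρ) =
      ∫ x, ρ.propose x.2 * ∫ m, h m x.1 ∂(ρ.message x.2) ∂(F ⊗ₘ t.rule) := by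
  have hmap : Measurable fun y : (State × S) × M => (y.2, y.1.1) := by fun_prop
  have hh' : Measurable fun y : (State × S) × M => h y.2 y.1.1 := hh.comp hmap
  rw [proposalLaw, integral_map hmap.aemeasurable
    (f := fun y : M × State => h y.1 y.2) hh.aestronglyMeasurable]
  have h1 := Measure.integral_compProd
    (μ := (F ⊗ₘ t.rule).withDensity fun x => ENNReal.ofReal (ρ.propose x.2))
    (κ := ρ.message.comap Prod.snd measurable_snd)
    (f := fun y : (State × S) × M => h y.2 y.1.1) (integrable_of_abs_le hh' fun x => hC _ _)
  have hd : Measurable fun x : State × S => ENNReal.ofReal (ρ.propose x.2) :=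
    ENNReal.measurable_ofReal.comp (ρ.measurable_propose.comp measurable_snd)
  refine h1.trans ?_
  rw [integral_withDensity_eq_integral_toReal_smul hd
    (Filter.Eventually.of_forall fun x => ENNReal.ofReal_lt_top)]
  refine integral_congr_ae (Filter.Eventually.of_forall fun x => ?_)
  simp only [ENNReal.toReal_ofReal (ρ.propose_mem _).1, smul_eq_mul, Kernel.comap_apply]

end Integrals

section Necessity

variable {n : ℕ} {S M : Type*} [MeasurableSpace S] [MeasurableSpace M]
  {F : Measure State} [IsProbabilityMeasure F] {k : ℕ} {ε c : ℝ} {α β : Fin n → ℝ}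

lemma measurable_launchProb (ρ : Assessment n S M) :
    Measurable (launchProb (linearGame k ε c α β) ρ) := by
  have h : Measurable fun m => fun i => ρ.vote i m := measurable_pi_lambda _ ρ.measurable_vote
  exact (continuous_launch k ε).measurable.comp h

lemma launchProb_mem (hε : 0 ≤ ε) (hε1 : ε ≤ 1) (ρ : Assessment n S M) (m : M) :
    launchProb (linearGame k ε c α β) ρ m ∈ Icc (0 : ℝ) 1 :=
  launch_mem k hε hε1 fun i => ρ.vote_mem i m

lemma abs_le_one_of_mem {x : ℝ} (hx : x ∈ Icc (0 : ℝ) 1) : |x| ≤ 1 := by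
  rw [abs_of_nonneg hx.1]
  exact hx.2

lemma integrable_launchProb (hε : 0 ≤ ε) (hε1 : ε ≤ 1) (ρ : Assessment n S M)
    (μ : Measure M) [IsFiniteMeasure μ] :
    Integrable (launchProb (linearGame k ε c α β) ρ) μ :=
  integrable_of_abs_le (measurable_launchProb ρ)
    fun m => abs_le_one_of_mem (launchProb_mem hε hε1 ρ m)

/-- The launch probability after a proposal at the signal `s`. -/
def signalLaunch (G : Game n) (ρ : Assessment n S M) (s : S) : ℝ :=
  ∫ m, launchProb G ρ m ∂(ρ.message s)

lemma measurable_signalLaunch (ρ : Assessment n S M) :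
    Measurable (signalLaunch (linearGame k ε c α β) ρ) :=
  (StronglyMeasurable.integral_kernel
    (measurable_launchProb (k := k) (ε := ε) (c := c) (α := α) (β := β) ρ).stronglyMeasurable).measurable

lemma signalLaunch_le {G : Game n} {ρ : Assessment n S M} {ℓ : ℝ} (s : S)
    (hint : Integrable (launchProb G ρ) (ρ.message s)) (h : ∀ m, launchProb G ρ m ≤ ℓ) :
    signalLaunch G ρ s ≤ ℓ := by
  have := integral_mono hint (integrable_const ℓ) h
  simpa [signalLaunch] using this

lemma signalLaunch_mem (hε : 0 ≤ ε) (hε1 : ε ≤ 1) (ρ : Assessment n S M) (s : S) :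
    signalLaunch (linearGame k ε c α β) ρ s ∈ Icc (0 : ℝ) 1 :=
  ⟨integral_nonneg fun m => (launchProb_mem hε hε1 ρ m).1,
    signalLaunch_le s (integrable_launchProb hε hε1 ρ _) fun m => (launchProb_mem hε hε1 ρ m).2⟩

lemma proposalValue_eq (hε : 0 ≤ ε) (hε1 : ε ≤ 1) (t : Test S) (ρ : Assessment n S M) (s : S) :
    proposalValue (linearGame k ε c α β) F t ρ s =
      principalValue (linearGame k ε c α β) F t s * signalLaunch (linearGame k ε c α β) ρ s - c := by
  rw [proposalValue, integral_sub ((integrable_launchProb hε hε1 ρ _).const_mul _)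
    (integrable_const _), integral_const_mul]
  simp [signalLaunch, linearGame]

lemma abs_mul_le_one {x y : ℝ} (hx : |x| ≤ 1) (hy : |y| ≤ 1) : |x * y| ≤ 1 := by
  rw [abs_mul]
  exact mul_le_one₀ hx (abs_nonneg _) hy

/-- The ex ante payoff as an integral over states and signals. -/
lemma payoff_eq_integral_joint (hε : 0 ≤ ε) (hε1 : ε ≤ 1) {t : Test S} {ρ : Assessment n S M}
    {ω : Outcome} (hind : Induces (linearGame k ε c α β) t ρ ω) :
    payoff (linearGame k ε c α β) F ω = ∫ x, ρ.propose x.2 *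
      ((x.1 : ℝ) * signalLaunch (linearGame k ε c α β) ρ x.2 - c) ∂(F ⊗ₘ t.rule) := by
  have hp := ρ.measurable_propose
  have hL := measurable_signalLaunch (k := k) (ε := ε) (c := c) (α := α) (β := β) ρ
  have hpb : ∀ s, |ρ.propose s| ≤ 1 := fun s => abs_le_one_of_mem (ρ.propose_mem s)
  have hLb : ∀ s, |signalLaunch (linearGame k ε c α β) ρ s| ≤ 1 :=
    fun s => abs_le_one_of_mem (signalLaunch_mem hε hε1 ρ s)
  rw [integral_joint t
    (h := fun θ s => ρ.propose s * ((θ : ℝ) * signalLaunch (linearGame k ε c α β) ρ s - c))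
    (C := 1 + |c|) ((hp.comp measurable_snd).mul
      (((measurable_state.comp measurable_fst).mul (hL.comp measurable_snd)).sub measurable_const))]
  · rw [payoff]
    refine integral_congr_ae (Filter.Eventually.of_forall fun θ => ?_)
    have h1 : ∀ s, ρ.propose s * ((θ : ℝ) * signalLaunch (linearGame k ε c α β) ρ s - c) =
        (θ : ℝ) * (ρ.propose s * signalLaunch (linearGame k ε c α β) ρ s) - c * ρ.propose s :=
      fun s => by ring
    have i1 : Integrable (fun s => ρ.propose s * signalLaunch (linearGame k ε c α β) ρ s)
        (t.rule θ) := integrable_of_abs_le (hp.mul hL) fun s => abs_mul_le_one (hpb s) (hLb s)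
    have i2 : Integrable (fun s => ρ.propose s) (t.rule θ) := integrable_of_abs_le hp hpb
    simp only [h1]
    rw [integral_sub (i1.const_mul _) (i2.const_mul _), integral_const_mul, integral_const_mul,
      ← (hind θ).1]
    have h2 := (hind θ).2
    simp only [signalLaunch]
    rw [← h2]
    simp only [linearGame]
    ring
  · intro θ s
    rw [abs_mul]
    have h1 := abs_mul_le_one (abs_state_le θ) (hLb s)
    have h2 : |(θ : ℝ) * signalLaunch (linearGame k ε c α β) ρ s - c| ≤ 1 + |c| :=
      (abs_sub _ _).trans (by linarith)
    calc _ ≤ 1 * (1 + |c|) := mul_le_mul (hpb s) h2 (abs_nonneg _) zero_le_one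
      _ = _ := one_mul _

/-- The state enters affinely, so after conditioning on the signal only the posterior mean is left.
-/
lemma integral_signal (t : Test S) {g g' : S → ℝ} (hg : Measurable g) (hg' : Measurable g')
    {C C' : ℝ} (hC : ∀ s, |g s| ≤ C) (hC' : ∀ s, |g' s| ≤ C') :
    ∫ x, (g x.2 * (x.1 : ℝ) + g' x.2) ∂(F ⊗ₘ t.rule) =
      ∫ s, (g s * principalValue (linearGame k ε c α β) F t s + g' s) ∂(F.bind t.rule) := by
  rw [integral_joint_eq_posterior t (h := fun θ s => g s * (θ : ℝ) + g' s) (C := C + C')]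
  · refine integral_congr_ae (Filter.Eventually.of_forall fun s => ?_)
    simp only
    rw [integral_add ((integrable_state _).const_mul _) (integrable_const _), integral_const_mul]
    simp [principalValue, linearGame]
  · exact ((hg.comp measurable_snd).mul (measurable_state.comp measurable_fst)).add
      (hg'.comp measurable_snd)
  · intro θ s
    refine (abs_add_le _ _).trans (add_le_add ?_ (hC' s))
    rw [abs_mul]
    calc _ ≤ |g s| * 1 := mul_le_mul_of_nonneg_left (abs_state_le θ) (abs_nonneg _)
      _ ≤ C := by rw [mul_one]; exact hC s

end Necessity

end

/-! ### What an equilibrium implies -/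

section

variable {n : ℕ} {S M : Type*} [MeasurableSpace S] [MeasurableSpace M]
  {F : Measure State} [IsProbabilityMeasure F] {k : ℕ} {ε c : ℝ} {α β : Fin n → ℝ}

lemma measurable_principalValue (t : Test S) :
    Measurable (principalValue (linearGame k ε c α β) F t) :=
  (StronglyMeasurable.integral_kernel measurable_state.stronglyMeasurable).measurable

lemma abs_integral_state_le (μ : Measure State) [IsProbabilityMeasure μ] :
    |∫ θ : State, (θ : ℝ) ∂μ| ≤ 1 := by
  have := norm_integral_le_of_norm_le_const (μ := μ) (f := fun θ : State => (θ : ℝ)) (C := 1)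
    (Filter.Eventually.of_forall abs_state_le)
  simpa using this

/-- The ex ante payoff as the expected value of proposing. -/
lemma payoff_eq_integral_signal (hε : 0 ≤ ε) (hε1 : ε ≤ 1) {t : Test S} {ρ : Assessment n S M}
    {ω : Outcome} (hind : Induces (linearGame k ε c α β) t ρ ω) :
    payoff (linearGame k ε c α β) F ω =
      ∫ s, ρ.propose s * proposalValue (linearGame k ε c α β) F t ρ s ∂(F.bind t.rule) := by
  have hp := ρ.measurable_propose
  have hL := measurable_signalLaunch (k := k) (ε := ε) (c := c) (α := α) (β := β) ρ
  have hpb : ∀ s, |ρ.propose s| ≤ 1 := fun s => abs_le_one_of_mem (ρ.propose_mem s)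
  have hLb : ∀ s, |signalLaunch (linearGame k ε c α β) ρ s| ≤ 1 :=
    fun s => abs_le_one_of_mem (signalLaunch_mem hε hε1 ρ s)
  have h1 := integral_signal (F := F) (k := k) (ε := ε) (c := c) (α := α) (β := β) t
    (g := fun s => ρ.propose s * signalLaunch (linearGame k ε c α β) ρ s)
    (g' := fun s => ρ.propose s * -c) (C := 1) (C' := 1 * |c|) (hp.mul hL)
    (hp.mul measurable_const) (fun s => abs_mul_le_one (hpb s) (hLb s)) (fun s => by
      rw [abs_mul, abs_neg]
      exact mul_le_mul_of_nonneg_right (hpb s) (abs_nonneg _))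
  rw [payoff_eq_integral_joint hε hε1 hind]
  refine Eq.trans ?_ (h1.trans ?_)
  · exact integral_congr_ae (Filter.Eventually.of_forall fun x => by simp only; ring)
  · exact integral_congr_ae (Filter.Eventually.of_forall fun s => by
      simp only [proposalValue_eq hε hε1]
      ring)

/-- In an equilibrium with a positive payoff, the launch probability is constant on path. -/
lemma exists_launch_level (hε : 0 ≤ ε) (hε1 : ε ≤ 1) (hc : 0 < c) {t : Test S}
    {ρ : Assessment n S M} {ω : Outcome} (hrat : PrincipalRational (linearGame k ε c α β) F t ρ)
    (hind : Induces (linearGame k ε c α β) t ρ ω)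
    (hpos : 0 < payoff (linearGame k ε c α β) F ω) :
    ∃ ℓ, 0 < ℓ ∧ (∀ m, launchProb (linearGame k ε c α β) ρ m ≤ ℓ) ∧
      (∃ m, launchProb (linearGame k ε c α β) ρ m = ℓ) ∧
      ∀ᵐ s ∂(F.bind t.rule), ρ.propose s * signalLaunch (linearGame k ε c α β) ρ s =
        ρ.propose s * ℓ := by
  rw [payoff_eq_integral_signal hε hε1 hind] at hpos
  -- A positive integral yields a signal after which proposing is strictly profitable and the
  -- message is optimal.
  have hfreq : ∃ s, ((∀ m, principalValue (linearGame k ε c α β) F t s *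
        launchProb (linearGame k ε c α β) ρ m - c ≤
          proposalValue (linearGame k ε c α β) F t ρ s) ∧
      0 < ρ.propose s * proposalValue (linearGame k ε c α β) F t ρ s) := by
    by_contra! hcon
    refine absurd hpos (not_lt.2 (integral_nonpos_of_ae ?_))
    filter_upwards [hrat] with s hs
    exact hcon s hs.1
  obtain ⟨s₀, hs₀, hpos₀⟩ := hfreq
  -- Because c > 0, a proposal worth making needs a positive posterior mean; messages are then
  -- ranked by launch probability alone.
  have aux : ∀ s, 0 ≤ proposalValue (linearGame k ε c α β) F t ρ s →
      0 < principalValue (linearGame k ε c α β) F t s := by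
    intro s hs
    rw [proposalValue_eq hε hε1] at hs
    have hL := signalLaunch_mem (k := k) (c := c) (α := α) (β := β) hε hε1 ρ s
    by_contra! hcon
    have := mul_nonpos_of_nonpos_of_nonneg hcon hL.1
    linarith
  have hv₀ : 0 < proposalValue (linearGame k ε c α β) F t ρ s₀ :=
    pos_of_mul_pos_right hpos₀ (ρ.propose_mem s₀).1
  have hy₀ := aux s₀ hv₀.le
  have hmax : ∀ m, launchProb (linearGame k ε c α β) ρ m ≤
      signalLaunch (linearGame k ε c α β) ρ s₀ := by
    intro m
    have := hs₀ m
    rw [proposalValue_eq hε hε1] at this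
    exact le_of_mul_le_mul_left (by linarith) hy₀
  -- Some message does at least as well as the average, and the average is already an upper bound.
  obtain ⟨m₀, hm₀⟩ := exists_integral_le
    (integrable_launchProb (k := k) (c := c) (α := α) (β := β) hε hε1 ρ (ρ.message s₀))
  have hm₀' : launchProb (linearGame k ε c α β) ρ m₀ =
      signalLaunch (linearGame k ε c α β) ρ s₀ := le_antisymm (hmax m₀) hm₀
  refine ⟨signalLaunch (linearGame k ε c α β) ρ s₀, ?_, hmax, ⟨m₀, hm₀'⟩, ?_⟩
  · rw [proposalValue_eq hε hε1] at hv₀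
    refine pos_of_mul_pos_right (a := principalValue (linearGame k ε c α β) F t s₀) ?_ hy₀.le
    linarith
  · filter_upwards [hrat] with s hs
    rcases (ρ.propose_mem s).1.lt_or_eq with hp | hp
    · have h0 := hs.2 0 (by simp)
      rw [zero_mul] at h0
      have hy := aux s (nonneg_of_mul_nonneg_right h0 hp)
      have h1 := hs.1 m₀
      rw [proposalValue_eq hε hε1, hm₀'] at h1
      have h2 : signalLaunch (linearGame k ε c α β) ρ s₀ ≤
          signalLaunch (linearGame k ε c α β) ρ s :=
        le_of_mul_le_mul_left (by simp only [linearGame] at h1 ⊢; linarith) hy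
      rw [le_antisymm (signalLaunch_le s (integrable_launchProb hε hε1 ρ _) hmax) h2]
    · rw [← hp, zero_mul, zero_mul]

/-- With a constant launch probability on path, the payoff depends on the proposals only. -/
lemma payoff_eq_of_launch_level (hε : 0 ≤ ε) (hε1 : ε ≤ 1) {t : Test S} {ρ : Assessment n S M}
    {ω : Outcome} (hind : Induces (linearGame k ε c α β) t ρ ω) {ℓ : ℝ}
    (hℓ : ∀ᵐ s ∂(F.bind t.rule), ρ.propose s * signalLaunch (linearGame k ε c α β) ρ s =
      ρ.propose s * ℓ) :
    payoff (linearGame k ε c α β) F ω =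
      ∫ x, ρ.propose x.2 * (ℓ * (x.1 : ℝ) - c) ∂(F ⊗ₘ t.rule) := by
  rw [payoff_eq_integral_joint hε hε1 hind]
  refine integral_congr_ae ?_
  have hsnd : ∀ᵐ x ∂(F ⊗ₘ t.rule), ρ.propose x.2 *
      signalLaunch (linearGame k ε c α β) ρ x.2 = ρ.propose x.2 * ℓ := by
    rw [← Measure.snd_compProd] at hℓ
    exact ae_of_ae_map measurable_snd.aemeasurable hℓ
  filter_upwards [hsnd] with x hx
  linear_combination (x.1 : ℝ) * hx

/-- The equilibrium payoff is at least that of always proposing. -/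
lemma always_propose_le (hε : 0 ≤ ε) (hε1 : ε ≤ 1) {t : Test S} {ρ : Assessment n S M}
    {ω : Outcome} (hrat : PrincipalRational (linearGame k ε c α β) F t ρ)
    (hind : Induces (linearGame k ε c α β) t ρ ω) {m : M} {ℓ : ℝ}
    (hm : launchProb (linearGame k ε c α β) ρ m = ℓ) :
    ℓ * (∫ θ : State, (θ : ℝ) ∂F) - c ≤ payoff (linearGame k ε c α β) F ω := by
  have h1 := integral_signal (F := F) (k := k) (ε := ε) (c := c) (α := α) (β := β) t
    (g := fun _ => ℓ) (g' := fun _ => -c) (C := |ℓ|) (C' := |c|) measurable_const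
    measurable_const (fun _ => le_rfl) (fun _ => (abs_neg c).le)
  have h2 := integral_joint_fst (F := F) t (f := fun θ => ℓ * (θ : ℝ) + -c)
    ((measurable_state.const_mul ℓ).add_const (-c)) (C := |ℓ| + |c|) (fun θ => by
      refine (abs_add_le _ _).trans (add_le_add ?_ (abs_neg c).le)
      rw [abs_mul]
      exact mul_le_of_le_one_right (abs_nonneg _) (abs_state_le θ))
  rw [integral_add ((integrable_state F).const_mul ℓ) (integrable_const _), integral_const_mul] at h2
  have h3 : ∫ _θ : State, -c ∂F = -c := by simp
  rw [h3] at h2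
  rw [sub_eq_add_neg, ← h2, h1, payoff_eq_integral_signal hε hε1 hind]
  have hyb : ∀ s, |principalValue (linearGame k ε c α β) F t s| ≤ 1 :=
    fun s => abs_integral_state_le _
  have hy := measurable_principalValue (F := F) (k := k) (ε := ε) (c := c) (α := α) (β := β) t
  have hpb : ∀ s, |ρ.propose s| ≤ 1 := fun s => abs_le_one_of_mem (ρ.propose_mem s)
  refine integral_mono_ae ?_ ?_ ?_
  · exact ((integrable_of_abs_le hy hyb).const_mul ℓ).add (integrable_const _)
  · simp only [proposalValue_eq hε hε1]
    refine integrable_of_abs_le (C := 1 * (1 + |c|)) (ρ.measurable_propose.mul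
      ((hy.mul (measurable_signalLaunch ρ)).sub_const c)) fun s => ?_
    rw [abs_mul]
    refine mul_le_mul (hpb s) ((abs_sub _ _).trans (add_le_add ?_ le_rfl)) (abs_nonneg _)
      zero_le_one
    exact abs_mul_le_one (hyb s) (abs_le_one_of_mem (signalLaunch_mem hε hε1 ρ s))
  · filter_upwards [hrat] with s hs
    have h4 := hs.1 m
    have h5 := hs.2 1 (by simp)
    rw [hm] at h4
    simp only [linearGame] at h4 h5 ⊢
    linarith

/-- On path, posterior means are compatible with the launch probability. -/
lemma ae_mean_mem (hε : 0 ≤ ε) (hε1 : ε ≤ 1) {t : Test S} {ρ : Assessment n S M}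
    (hag : AgentsRational (linearGame k ε c α β) ρ) (hbayes : BayesConsistent F t ρ) {ℓ : ℝ}
    (hmax : ∀ m, launchProb (linearGame k ε c α β) ρ m ≤ ℓ)
    (hℓ : ∀ᵐ s ∂(F.bind t.rule), ρ.propose s * signalLaunch (linearGame k ε c α β) ρ s =
      ρ.propose s * ℓ) :
    ∀ᵐ m ∂(proposalLaw F t ρ).fst, (∫ θ : State, (θ : ℝ) ∂((proposalLaw F t ρ).condKernel m)) ∈
      means k ε α β ℓ := by
  -- Bayes' rule pins the beliefs of all agents to one conditional law, almost surely on path.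
  have hbel : ∀ᵐ m ∂(proposalLaw F t ρ).fst, ∀ i, ρ.belief i m =
      (proposalLaw F t ρ).condKernel m :=
    ae_all_iff.2 fun i => eq_condKernel_of_measure_eq_compProd _ (hbayes i)
  have hL := measurable_launchProb (k := k) (ε := ε) (c := c) (α := α) (β := β) ρ
  have hLb : ∀ m, |launchProb (linearGame k ε c α β) ρ m| ≤ 1 :=
    fun m => abs_le_one_of_mem (launchProb_mem hε hε1 ρ m)
  have hb : ∀ m, |ℓ - launchProb (linearGame k ε c α β) ρ m| ≤ |ℓ| + 1 :=
    fun m => (abs_sub _ _).trans (add_le_add le_rfl (hLb m))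
  -- The shortfall from ℓ is nonnegative and integrates to zero over on-path messages, so it
  -- vanishes almost surely.
  have hint : ∫ m, (ℓ - launchProb (linearGame k ε c α β) ρ m) ∂(proposalLaw F t ρ).fst = 0 := by
    rw [Measure.fst, integral_map measurable_fst.aemeasurable
      (f := fun m => ℓ - launchProb (linearGame k ε c α β) ρ m)
      (measurable_const.sub hL).aestronglyMeasurable,
      integral_proposalLaw t ρ (h := fun m _ => ℓ - launchProb (linearGame k ε c α β) ρ m)
        (measurable_const.sub (hL.comp measurable_fst)) fun m _ => hb m]
    have hsnd : ∀ᵐ x ∂(F ⊗ₘ t.rule), ρ.propose x.2 *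
        signalLaunch (linearGame k ε c α β) ρ x.2 = ρ.propose x.2 * ℓ := by
      rw [← Measure.snd_compProd] at hℓ
      exact ae_of_ae_map measurable_snd.aemeasurable hℓ
    refine integral_eq_zero_of_ae ?_
    filter_upwards [hsnd] with x hx
    rw [integral_sub (integrable_const _) (integrable_launchProb hε hε1 ρ _)]
    simp only [integral_const, probReal_univ, one_smul, Pi.zero_apply]
    rw [signalLaunch] at hx
    linarith
  have hlev := (integral_eq_zero_iff_of_nonneg (fun m => sub_nonneg.2 (hmax m))
    (integrable_of_abs_le (measurable_const.sub hL) hb)).1 hint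
  filter_upwards [hbel, hlev] with m hm hm'
  refine ⟨(_, fun i => ρ.vote i m), ⟨⟨abs_le.1 (abs_integral_state_le _),
    fun i => ρ.vote_mem i m, fun i y hy => ?_⟩, ?_⟩, rfl⟩
  · have h1 := hag i m y hy
    have h2 : ∫ θ, (linearGame k ε c α β).v i θ ∂(ρ.belief i m) =
        α i * (∫ θ : State, (θ : ℝ) ∂((proposalLaw F t ρ).condKernel m)) + β i := by
      rw [hm i]
      simp only [linearGame]
      rw [integral_add ((integrable_state _).const_mul _) (integrable_const _), integral_const_mul]
      simp
    rw [h2] at h1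
    exact h1
  · have : ℓ - launchProb (linearGame k ε c α β) ρ m = 0 := hm'
    change launchProb (linearGame k ε c α β) ρ m = ℓ
    linarith

/-- The payoff of an equilibrium satisfies the dual bounds of the bi-pooling problem. -/
lemma dualBound_of_equilibrium (hε : 0 ≤ ε) (hε1 : ε ≤ 1) (hF : ∀ θ, F {θ} = 0)
    {t : Test S} {ρ : Assessment n S M} {ω : Outcome}
    (hag : AgentsRational (linearGame k ε c α β) ρ) (hbayes : BayesConsistent F t ρ)
    (hind : Induces (linearGame k ε c α β) t ρ ω) {ℓ : ℝ} (hℓ0 : 0 < ℓ)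
    (hmax : ∀ m, launchProb (linearGame k ε c α β) ρ m ≤ ℓ)
    (hℓ : ∀ᵐ s ∂(F.bind t.rule), ρ.propose s * signalLaunch (linearGame k ε c α β) ρ s =
      ρ.propose s * ℓ) :
    TailData.DualBound (mass F) (moment F) (means k ε α β ℓ) (c / ℓ)
      (payoff (linearGame k ε c α β) F ω / ℓ) := by
  intro κ s r a b hκ hs hr _ _ hle
  have hmean := ae_mean_mem hε hε1 hag hbayes hmax hℓ
  set Q := proposalLaw F t ρ with hQ
  set w : State → ℝ := fun θ => κ + s * max ((θ : ℝ) - a) 0 + r * max ((θ : ℝ) - b) 0 with hw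
  have hmaxm : ∀ d : ℝ, Measurable fun θ : State => max ((θ : ℝ) - d) 0 := fun d =>
    (measurable_state.sub_const d).max measurable_const
  have hmaxb : ∀ (d : ℝ) (θ : State), |max ((θ : ℝ) - d) 0| ≤ 1 + |d| := by
    intro d θ
    have h1 : |max ((θ : ℝ) - d) 0| ≤ |(θ : ℝ) - d| := by
      rw [abs_of_nonneg (le_max_right _ _)]
      exact max_le (le_abs_self _) (abs_nonneg _)
    exact h1.trans ((abs_sub _ _).trans (add_le_add (abs_state_le θ) le_rfl))
  have hmaxi : ∀ (d : ℝ) (μ : Measure State) [IsFiniteMeasure μ],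
      Integrable (fun θ : State => max ((θ : ℝ) - d) 0) μ :=
    fun d μ _ => integrable_of_abs_le (hmaxm d) (hmaxb d)
  have hwm : Measurable w :=
    (((hmaxm a).const_mul s).const_add κ).add ((hmaxm b).const_mul r)
  have hw0 : ∀ θ, 0 ≤ w θ := fun θ => by positivity
  have hwb : ∀ θ, |w θ| ≤ κ + s * (1 + |a|) + r * (1 + |b|) := by
    intro θ
    rw [abs_of_nonneg (hw0 θ)]
    have h1 := mul_le_mul_of_nonneg_left ((le_abs_self _).trans (hmaxb a θ)) hs
    have h2 := mul_le_mul_of_nonneg_left ((le_abs_self _).trans (hmaxb b θ)) hr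
    simp only [hw]
    linarith
  have hwint : ∀ (μ : Measure State) [IsProbabilityMeasure μ], ∫ θ, w θ ∂μ =
      κ + s * (∫ θ : State, max ((θ : ℝ) - a) 0 ∂μ) + r * ∫ θ : State, max ((θ : ℝ) - b) 0 ∂μ := by
    intro μ _
    simp only [hw]
    have hi : Integrable (fun θ : State => κ + s * max ((θ : ℝ) - a) 0) μ :=
      (integrable_const _).add ((hmaxi a μ).const_mul s)
    rw [integral_add hi ((hmaxi b μ).const_mul r), integral_add (integrable_const _) ((hmaxi a μ).const_mul s),
      integral_const_mul, integral_const_mul]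
    simp
  have hjensen : ∀ (d : ℝ) (μ : Measure State) [IsProbabilityMeasure μ],
      max ((∫ θ : State, (θ : ℝ) ∂μ) - d) 0 ≤ ∫ θ : State, max ((θ : ℝ) - d) 0 ∂μ := by
    intro d μ _
    refine max_le ?_ (integral_nonneg fun θ => le_max_right _ _)
    have h1 : (∫ θ : State, (θ : ℝ) ∂μ) - d = ∫ θ : State, ((θ : ℝ) - d) ∂μ := by
      rw [integral_sub (integrable_state μ) (integrable_const _)]
      simp
    rw [h1]
    exact integral_mono ((integrable_state μ).sub (integrable_const _)) (hmaxi d μ)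
      fun θ => le_max_left _ _
  have hθp : Measurable fun y : M × State => (y.2 : ℝ) - c / ℓ :=
    (measurable_state.comp measurable_snd).sub_const _
  have hθpb : ∀ θ : State, |(θ : ℝ) - c / ℓ| ≤ 1 + |c / ℓ| :=
    fun θ => (abs_sub _ _).trans (add_le_add (abs_state_le θ) le_rfl)
  have hθpi : Integrable (fun y : M × State => (y.2 : ℝ) - c / ℓ) Q :=
    integrable_of_abs_le hθp fun y => hθpb y.2
  have hwi : Integrable (fun y : M × State => w y.2) Q :=
    integrable_of_abs_le (hwm.comp measurable_snd) fun y => hwb y.2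
  have hdis : Q.fst ⊗ₘ Q.condKernel = Q := Q.disintegrate Q.condKernel
  have step1 : payoff (linearGame k ε c α β) F ω / ℓ = ∫ y, ((y.2 : ℝ) - c / ℓ) ∂Q := by
    rw [hQ, integral_proposalLaw t ρ (h := fun _ θ => (θ : ℝ) - c / ℓ) hθp fun _ θ => hθpb θ,
      payoff_eq_of_launch_level hε hε1 hind hℓ, ← integral_div]
    refine integral_congr_ae (Filter.Eventually.of_forall fun x => ?_)
    simp only [integral_const, probReal_univ, one_smul]
    field_simp
  -- Jensen's inequality message by message; the majorant is needed only at posterior means, which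
  -- lie in the admissible set.
  have step2 : ∫ y, ((y.2 : ℝ) - c / ℓ) ∂Q ≤ ∫ y, w y.2 ∂Q := by
    rw [← hdis] at hθpi hwi ⊢
    rw [Measure.integral_compProd hθpi, Measure.integral_compProd hwi]
    refine integral_mono_ae hθpi.integral_compProd hwi.integral_compProd ?_
    filter_upwards [hmean] with m hm
    rw [integral_sub (integrable_state _) (integrable_const _), hwint]
    simp only [integral_const, probReal_univ, one_smul]
    refine (hle _ hm).trans ?_
    have h1 := mul_le_mul_of_nonneg_left (hjensen a (Q.condKernel m)) hs
    have h2 := mul_le_mul_of_nonneg_left (hjensen b (Q.condKernel m)) hr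
    linarith
  -- The law of proposed states is dominated by F, and w ≥ 0.
  have step3 : ∫ y, w y.2 ∂Q ≤ ∫ θ, w θ ∂F := by
    rw [hQ, integral_proposalLaw t ρ (h := fun _ θ => w θ) (hwm.comp measurable_snd)
      fun _ θ => hwb θ, ← integral_joint_fst t hwm hwb]
    simp only [integral_const, probReal_univ, one_smul]
    refine integral_mono ?_ (integrable_of_abs_le (hwm.comp measurable_fst) fun x => hwb x.1) ?_
    · refine integrable_of_abs_le (C := κ + s * (1 + |a|) + r * (1 + |b|))
        ((ρ.measurable_propose.comp measurable_snd).mul (hwm.comp measurable_fst)) fun x => ?_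
      rw [abs_mul]
      exact (mul_le_of_le_one_left (abs_nonneg _) (abs_le_one_of_mem (ρ.propose_mem _))).trans
        (hwb x.1)
    · exact fun x => mul_le_of_le_one_left (hw0 x.1) (ρ.propose_mem _).2
  rw [step1]
  refine (step2.trans step3).trans_eq ?_
  rw [hwint, tail_self_eq_integral hF, tail_self_eq_integral hF]

/-- The payoff of every equilibrium is either nonpositive or bounded by that of a bi-pool. -/
theorem exists_biPool_of_equilibrium (hε : 0 ≤ ε) (hε1 : ε ≤ 1) (hc : 0 < c)
    (hF : ∀ θ, F {θ} = 0) {t : Test S} {ρ : Assessment n S M} {ω : Outcome}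
    (heq : IsPublicEquilibrium (linearGame k ε c α β) F t ρ)
    (hind : Induces (linearGame k ε c α β) t ρ ω)
    (hpos : 0 < payoff (linearGame k ε c α β) F ω) :
    ∃ ℓ > 0, ∃ a b₁ b₂, ∃ x₁ ∈ means k ε α β ℓ, ∃ x₂ ∈ means k ε α β ℓ, c / ℓ ≤ x₁ ∧ c / ℓ ≤ x₂ ∧
      TailData.BiPool (mass F) (moment F) a b₁ b₂ x₁ x₂ ∧
      payoff (linearGame k ε c α β) F ω / ℓ ≤ tail (mass F) (moment F) (c / ℓ) a ∧
      tail (mass F) (moment F) (c / ℓ) (-1) ≤ payoff (linearGame k ε c α β) F ω / ℓ := by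
  obtain ⟨ℓ, hℓ0, hmax, ⟨m, hm⟩, hℓ⟩ := exists_launch_level hε hε1 hc heq.principal hind hpos
  have hA := dualBound_of_equilibrium hε hε1 hF heq.agents heq.bayes hind hℓ0 hmax hℓ
  have hB : tail (mass F) (moment F) (c / ℓ) (-1) ≤
      payoff (linearGame k ε c α β) F ω / ℓ := by
    have := always_propose_le hε hε1 heq.principal hind hm
    rw [tail_neg_one hF, le_div_iff₀ hℓ0, sub_mul, div_mul_cancel₀ _ hℓ0.ne']
    linarith
  obtain ⟨a, b₁, b₂, x₁, hx₁, x₂, hx₂, h1, h2, h3, h4⟩ := (tailData hF).exists_biPool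
    (isCompact_means k ε α β ℓ) (means_subset k ε α β ℓ)
    (by have := div_pos hc hℓ0; linarith) (div_pos hpos hℓ0) hA hB
  exact ⟨ℓ, hℓ0, a, b₁, b₂, x₁, hx₁, x₂, hx₂, h1, h2, h3, h4, hB⟩

end

/-! ### The threshold test and its posteriors -/

section

open Classical in
/-- The signal of the threshold test with cells `[a, b₁) ∪ [b₂, 1]` and `[b₁, b₂)`. -/
def poolSignal (a b₁ b₂ : ℝ) (θ : State) : Signal :=
  if (θ : ℝ) < a then Signal.minus
  else if θ ∈ below b₂ \ below b₁ then Signal.plus₂ else Signal.plus₁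

instance : Finite Signal :=
  Finite.of_surjective (fun i : Fin 3 => ![Signal.minus, Signal.plus₁, Signal.plus₂] i) fun s => by
    cases s
    · exact ⟨0, rfl⟩
    · exact ⟨1, rfl⟩
    · exact ⟨2, rfl⟩

instance : DiscreteMeasurableSpace Signal := ⟨fun _ => MeasurableSpace.measurableSet_top⟩

lemma measurable_poolSignal (a b₁ b₂ : ℝ) : Measurable (poolSignal a b₁ b₂) := by
  classical
  exact Measurable.ite (measurableSet_below a) measurable_const
    (Measurable.ite ((measurableSet_below b₂).diff (measurableSet_below b₁)) measurable_const
      measurable_const)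

/-- The deterministic test that sends `poolSignal`. -/
def poolTest (a b₁ b₂ : ℝ) : Test Signal where
  rule := Kernel.deterministic (poolSignal a b₁ b₂) (measurable_poolSignal a b₁ b₂)
  isMarkov := inferInstance

/-- Propose unless the signal is `s⁻`. -/
def proposeUnlessMinus : Signal → ℝ
  | Signal.minus => 0
  | Signal.plus₁ => 1
  | Signal.plus₂ => 1

lemma proposeUnlessMinus_mem (s : Signal) : proposeUnlessMinus s ∈ Icc (0 : ℝ) 1 := by
  cases s <;> simp [proposeUnlessMinus]

/-- The outcome with proposals above the threshold and constant launch probability. -/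
def poolOutcome (a b₁ b₂ ℓ : ℝ) (hℓ : ℓ ∈ Icc (0 : ℝ) 1) : Outcome where
  p := fun θ => proposeUnlessMinus (poolSignal a b₁ b₂ θ)
  l := fun _ => ℓ
  p_mem := fun _ => proposeUnlessMinus_mem _
  l_mem := fun _ => hℓ

section Cells

variable {a b₁ b₂ : ℝ}

lemma poolSignal_of_lt {θ : State} (h : (θ : ℝ) < a) : poolSignal a b₁ b₂ θ = Signal.minus := by
  simp [poolSignal, h]

lemma poolSignal_of_inner (hab : a ≤ b₁) {θ : State} (h1 : b₁ ≤ (θ : ℝ)) (h2 : (θ : ℝ) < b₂) :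
    poolSignal a b₁ b₂ θ = Signal.plus₂ := by
  have h : θ ∈ below b₂ \ below b₁ := ⟨h2, not_lt.2 h1⟩
  simp [poolSignal, h, hab.trans h1]

lemma poolSignal_of_outer {θ : State} (ha : a ≤ (θ : ℝ)) (h : (θ : ℝ) < b₁ ∨ b₂ ≤ (θ : ℝ)) :
    poolSignal a b₁ b₂ θ = Signal.plus₁ := by
  have h' : θ ∉ below b₂ \ below b₁ := fun hθ => h.elim hθ.2 fun h2 => not_lt.2 h2 hθ.1
  simp [poolSignal, h', ha]

lemma isBiPooledThreshold_poolTest (ha : a ∈ Icc (-1 : ℝ) 1) (hab : a ≤ b₁) (hb : b₁ ≤ b₂) :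
    IsBiPooledThreshold (poolTest a b₁ b₂) := by
  have hone : ∀ (θ : State) (s : Signal), poolSignal a b₁ b₂ θ = s →
      (poolTest a b₁ b₂).rule θ {s} = 1 := by
    intro θ s hs
    rw [poolTest, Kernel.deterministic_apply' _ _ (MeasurableSet.singleton s)]
    simp [hs]
  refine ⟨⟨a, ha⟩, {θ | a ≤ (θ : ℝ) ∧ (θ : ℝ) < b₁}, {θ | b₁ ≤ (θ : ℝ) ∧ (θ : ℝ) < b₂},
    {θ | b₂ ≤ (θ : ℝ)}, ?_, ?_, ?_, ?_, ?_, ?_, ?_⟩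
  · ext θ
    simp only [mem_union, mem_ofPred_eq, mem_Ici, ← Subtype.coe_le_coe]
    constructor
    · rintro ((h | h) | h) <;> linarith
    · intro h
      by_cases h1 : (θ : ℝ) < b₁
      · exact Or.inl (Or.inl ⟨h, h1⟩)
      · by_cases h2 : (θ : ℝ) < b₂
        · exact Or.inl (Or.inr ⟨not_lt.1 h1, h2⟩)
        · exact Or.inr (not_lt.1 h2)
  · exact fun x hx y hy => Subtype.coe_lt_coe.1 (hx.2.trans_le hy.1)
  · exact fun x hx y hy => Subtype.coe_lt_coe.1 (hx.2.trans_le hy)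
  · exact fun x hx y hy => Subtype.coe_lt_coe.1 (hx.2.trans_le (hb.trans hy))
  · exact fun θ hθ => hone θ _ (poolSignal_of_lt (Subtype.coe_lt_coe.2 hθ))
  · rintro θ (hθ | hθ)
    · exact hone θ _ (poolSignal_of_outer hθ.1 (Or.inl hθ.2))
    · exact hone θ _ (poolSignal_of_outer (hab.trans (hb.trans hθ)) (Or.inr hθ))
  · exact fun θ hθ => hone θ _ (poolSignal_of_inner hab hθ.1 hθ.2)

/-- The cell of states with a given signal. -/
def cell (a b₁ b₂ : ℝ) (s : Signal) : Set State := poolSignal a b₁ b₂ ⁻¹' {s}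

lemma measurableSet_cell (s : Signal) : MeasurableSet (cell a b₁ b₂ s) :=
  measurable_poolSignal a b₁ b₂ (MeasurableSet.singleton s)

lemma cell_minus : cell a b₁ b₂ Signal.minus = below a := by
  ext θ
  by_cases h : (θ : ℝ) < a
  · simp [cell, poolSignal, below, h]
  · simp only [cell, poolSignal, mem_preimage, h, if_false, mem_singleton_iff]
    split_ifs <;> simp [below, h]

lemma cell_plus₂ (hab : a ≤ b₁) : cell a b₁ b₂ Signal.plus₂ = below b₂ \ below b₁ := by
  ext θ
  by_cases h : (θ : ℝ) < a
  · have : θ ∈ below b₁ := h.trans_le hab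
    simp [cell, poolSignal, h, this]
  · simp only [cell, poolSignal, mem_preimage, h, if_false, mem_singleton_iff]
    split_ifs with h1 <;> simp [h1]

lemma cell_plus₁ (hab : a ≤ b₁) (hb : b₁ ≤ b₂) :
    cell a b₁ b₂ Signal.plus₁ = (below b₁ \ below a) ∪ (below b₂)ᶜ := by
  ext θ
  simp only [cell, mem_preimage, mem_singleton_iff, mem_union, mem_sdiff, mem_compl_iff, below,
    mem_ofPred_eq, not_lt]
  constructor
  · intro hθ
    by_contra! hcon
    by_cases h : (θ : ℝ) < a
    · rw [poolSignal_of_lt h] at hθ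
      exact Signal.noConfusion hθ
    · have h1 : b₁ ≤ (θ : ℝ) := by
        by_contra! h1
        exact h (hcon.1 h1)
      rw [poolSignal_of_inner hab h1 hcon.2] at hθ
      exact Signal.noConfusion hθ
  · rintro (h | h)
    · exact poolSignal_of_outer h.2 (Or.inl h.1)
    · exact poolSignal_of_outer (hab.trans (hb.trans h)) (Or.inr h)

variable {F : Measure State}

lemma real_cell (s : Signal) :
    F.real (cell a b₁ b₂ s) = ∫ _θ in cell a b₁ b₂ s, (1 : ℝ) ∂F := by
  simp

lemma bind_poolTest_singleton (s : Signal) :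
    F.bind (poolTest a b₁ b₂).rule {s} = F (cell a b₁ b₂ s) := by
  rw [poolTest, Measure.deterministic_comp_eq_map, Measure.map_apply
    (measurable_poolSignal a b₁ b₂) (MeasurableSet.singleton s)]
  rfl

variable [IsProbabilityMeasure F]

lemma integral_cell_plus₂ (hab : a ≤ b₁) (hb : b₁ ≤ b₂) {f : State → ℝ} (hf : Integrable f F) :
    ∫ θ in cell a b₁ b₂ Signal.plus₂, f θ ∂F =
      (∫ θ in below b₂, f θ ∂F) - ∫ θ in below b₁, f θ ∂F := by
  rw [cell_plus₂ hab, integral_below_sub hf hb]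

lemma integral_cell_plus₁ (hF : ∀ θ, F {θ} = 0) (hab : a ≤ b₁) (hb : b₁ ≤ b₂) {f : State → ℝ}
    (hf : Integrable f F) :
    ∫ θ in cell a b₁ b₂ Signal.plus₁, f θ ∂F =
      ((∫ θ in below b₁, f θ ∂F) - ∫ θ in below a, f θ ∂F) +
        ((∫ θ in below 1, f θ ∂F) - ∫ θ in below b₂, f θ ∂F) := by
  rw [cell_plus₁ hab hb, setIntegral_union ?_ (measurableSet_below b₂).compl hf.integrableOn
    hf.integrableOn, integral_below_sub hf hab, integral_compl_below hF hf]
  exact disjoint_left.2 fun θ hθ hθ' => hθ' (hθ.1.trans_le hb)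

lemma real_cell_plus₂ (hab : a ≤ b₁) (hb : b₁ ≤ b₂) :
    F.real (cell a b₁ b₂ Signal.plus₂) = mass F b₂ - mass F b₁ := by
  rw [real_cell, integral_cell_plus₂ hab hb (integrable_const _), ← mass_eq_integral,
    ← mass_eq_integral]

lemma real_cell_plus₁ (hF : ∀ θ, F {θ} = 0) (hab : a ≤ b₁) (hb : b₁ ≤ b₂) :
    F.real (cell a b₁ b₂ Signal.plus₁) = (mass F b₁ - mass F a) + (1 - mass F b₂) := by
  rw [real_cell, integral_cell_plus₁ hF hab hb (integrable_const _), ← mass_eq_integral,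
    ← mass_eq_integral, ← mass_eq_integral, ← mass_eq_integral, (tailData hF).one]

/-- The posterior mean after a signal of the threshold test. -/
lemma principalValue_mul_real {n k : ℕ} {ε c : ℝ} {α β : Fin n → ℝ} (s : Signal) :
    principalValue (linearGame k ε c α β) F (poolTest a b₁ b₂) s * F.real (cell a b₁ b₂ s) =
      ∫ θ in cell a b₁ b₂ s, (θ : ℝ) ∂F := by
  classical
  -- Test the posterior identity with the indicator of s; keeping the mass as a factor covers null
  -- cells too.
  set g : Signal → ℝ := fun s' => if s' = s then 1 else 0 with hg
  have hgm : Measurable g := Measurable.of_discrete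
  have hgb : ∀ s', |g s'| ≤ 1 := by
    intro s'
    simp only [hg]
    split_ifs <;> simp
  have h1 := integral_signal (F := F) (k := k) (ε := ε) (c := c) (α := α) (β := β)
    (poolTest a b₁ b₂) (g := g) (g' := fun _ => 0) (C' := 0) hgm measurable_const hgb (by simp)
  simp only [add_zero] at h1
  rw [integral_joint (poolTest a b₁ b₂) (h := fun θ s' => g s' * (θ : ℝ)) (C := 1)
    ((hgm.comp measurable_snd).mul (measurable_state.comp measurable_fst))
    (fun θ s' => abs_mul_le_one (hgb s') (abs_state_le θ))] at h1
  have h2 : ∀ θ : State, ∫ s', g s' * (θ : ℝ) ∂((poolTest a b₁ b₂).rule θ) =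
      (cell a b₁ b₂ s).indicator (fun θ : State => (θ : ℝ)) θ := by
    intro θ
    rw [poolTest, Kernel.integral_deterministic]
    by_cases h : θ ∈ cell a b₁ b₂ s
    · have h' : poolSignal a b₁ b₂ θ = s := h
      rw [indicator_of_mem h]
      simp [hg, h']
    · have h' : ¬ poolSignal a b₁ b₂ θ = s := h
      rw [indicator_of_notMem h]
      simp [hg, h']
  simp only [h2] at h1
  rw [integral_indicator (measurableSet_cell s)] at h1
  rw [h1]
  have h3 : ∀ s', g s' * principalValue (linearGame k ε c α β) F (poolTest a b₁ b₂) s' =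
      ({s} : Set Signal).indicator
        (fun _ => principalValue (linearGame k ε c α β) F (poolTest a b₁ b₂) s) s' := by
    intro s'
    by_cases h : s' = s
    · simp [hg, h]
    · simp [hg, h]
  simp only [h3]
  rw [integral_indicator (MeasurableSet.singleton s), setIntegral_const, smul_eq_mul, mul_comm]
  congr 1
  rw [poolTest, Measure.deterministic_comp_eq_map, map_measureReal_apply
    (measurable_poolSignal a b₁ b₂) (MeasurableSet.singleton s)]
  rfl

/-- A belief with mean `x` that is the conditional law given the cell `C`, when that makes sense. -/
lemma exists_belief {C : Set State} {x : ℝ} (hx : x ∈ Icc (-1 : ℝ) 1)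
    (hC : ∫ θ in C, (θ : ℝ) ∂F = x * F.real C) :
    ∃ B : Measure State, IsProbabilityMeasure B ∧ F.restrict C = F C • B ∧
      ∫ θ : State, (θ : ℝ) ∂B = x := by
  by_cases h0 : F C = 0
  -- After a null cell the belief is free; a point mass at x keeps the prescribed votes optimal.
  · refine ⟨Measure.dirac ⟨x, hx⟩, inferInstance, ?_, ?_⟩
    · rw [h0, zero_smul, Measure.restrict_eq_zero]
      exact h0
    · rw [integral_dirac' _ _ measurable_state.stronglyMeasurable]
  · refine ⟨F[|C], cond_isProbabilityMeasure h0, ?_, ?_⟩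
    · rw [ProbabilityTheory.cond, smul_smul, ENNReal.mul_inv_cancel h0 (measure_ne_top F C),
        one_smul]
    · have hr : F.real C ≠ 0 := by
        rw [measureReal_def, ENNReal.toReal_ne_zero]
        exact ⟨h0, measure_ne_top F C⟩
      rw [ProbabilityTheory.cond, integral_smul_measure, hC, ENNReal.toReal_inv, smul_eq_mul,
        ← measureReal_def]
      field_simp

end Cells

end

/-! ### The truthful equilibrium -/

section

variable {n : ℕ} {M : Type*} [MeasurableSpace M] {F : Measure State}

open Classical in
/-- Truthful reporting: propose and report the signal unless it is `s⁻`; the message `e s₂⁺` is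
answered by the votes `τ₂` and the belief `B₂`, and all others by `τ₁` and `B₁`. -/
def truthful (e : Signal → M) (he : MeasurableEmbedding e) (τ₁ τ₂ : Fin n → ℝ)
    (h₁ : ∀ i, τ₁ i ∈ Icc (0 : ℝ) 1) (h₂ : ∀ i, τ₂ i ∈ Icc (0 : ℝ) 1)
    (B₁ B₂ : Measure State) [IsProbabilityMeasure B₁] [IsProbabilityMeasure B₂] :
    Assessment n Signal M where
  propose := proposeUnlessMinus
  measurable_propose := Measurable.of_discrete
  propose_mem := proposeUnlessMinus_mem
  message := Kernel.deterministic e he.measurable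
  message_isMarkov := inferInstance
  vote := fun i m => if m ∈ e '' {Signal.plus₂} then τ₂ i else τ₁ i
  measurable_vote := fun _ =>
    Measurable.ite (he.measurableSet_image.2 (MeasurableSet.singleton Signal.plus₂)) measurable_const
      measurable_const
  vote_mem := fun i m => by
    split_ifs
    · exact h₂ i
    · exact h₁ i
  belief := fun _ => Kernel.piecewise (he.measurableSet_image.2 (MeasurableSet.singleton Signal.plus₂))
    (Kernel.const M B₂) (Kernel.const M B₁)
  belief_isMarkov := fun _ => inferInstance

section Truthful

variable {e : Signal → M} {he : MeasurableEmbedding e} {τ₁ τ₂ : Fin n → ℝ}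
  {h₁ : ∀ i, τ₁ i ∈ Icc (0 : ℝ) 1} {h₂ : ∀ i, τ₂ i ∈ Icc (0 : ℝ) 1}
  {B₁ B₂ : Measure State} [IsProbabilityMeasure B₁] [IsProbabilityMeasure B₂]
  {k : ℕ} {ε c : ℝ} {α β : Fin n → ℝ}

lemma truthful_response (m : M) :
    ((fun i => (truthful e he τ₁ τ₂ h₁ h₂ B₁ B₂).vote i m) = τ₂ ∧
      ∀ i, (truthful e he τ₁ τ₂ h₁ h₂ B₁ B₂).belief i m = B₂) ∨
    ((fun i => (truthful e he τ₁ τ₂ h₁ h₂ B₁ B₂).vote i m) = τ₁ ∧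
      ∀ i, (truthful e he τ₁ τ₂ h₁ h₂ B₁ B₂).belief i m = B₁) := by
  by_cases h : m ∈ e '' {Signal.plus₂}
  · refine Or.inl ⟨funext fun i => ?_, fun i => ?_⟩
    · simp only [truthful, h, if_true]
    · simp only [truthful, Kernel.piecewise_apply, h, if_true, Kernel.const_apply]
  · refine Or.inr ⟨funext fun i => ?_, fun i => ?_⟩
    · simp only [truthful, h, if_false]
    · simp only [truthful, Kernel.piecewise_apply, h, if_false, Kernel.const_apply]

lemma truthful_belief_plus₂ (i : Fin n) :
    (truthful e he τ₁ τ₂ h₁ h₂ B₁ B₂).belief i (e Signal.plus₂) = B₂ := by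
  simp [truthful, Kernel.piecewise_apply, Kernel.const_apply]

lemma truthful_belief_plus₁ (i : Fin n) :
    (truthful e he τ₁ τ₂ h₁ h₂ B₁ B₂).belief i (e Signal.plus₁) = B₁ := by
  have h : e Signal.plus₁ ∉ e '' {Signal.plus₂} := by
    rintro ⟨s, hs, hs'⟩
    rw [mem_singleton_iff] at hs
    subst hs
    exact Signal.noConfusion (he.injective hs')
  simp only [truthful, Kernel.piecewise_apply, h, if_false, Kernel.const_apply]

/-- Both vote profiles yield ℓ and every message is answered by one of them, so the principal is
indifferent between all messages and truth-telling is optimal. -/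
lemma launchProb_truthful {ℓ : ℝ} (hℓ₁ : launch k ε τ₁ = ℓ) (hℓ₂ : launch k ε τ₂ = ℓ) (m : M) :
    launchProb (linearGame k ε c α β) (truthful e he τ₁ τ₂ h₁ h₂ B₁ B₂) m = ℓ := by
  change launch k ε (fun i => (truthful e he τ₁ τ₂ h₁ h₂ B₁ B₂).vote i m) = ℓ
  rcases truthful_response (e := e) (he := he) (h₁ := h₁) (h₂ := h₂) (B₁ := B₁) (B₂ := B₂) m with
    ⟨h, -⟩ | ⟨h, -⟩
  · rw [h, hℓ₂]
  · rw [h, hℓ₁]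

lemma agentsRational_truthful {x₁ x₂ : ℝ} (hr₁ : (x₁, τ₁) ∈ replies k ε α β)
    (hr₂ : (x₂, τ₂) ∈ replies k ε α β) (hB₁ : ∫ θ : State, (θ : ℝ) ∂B₁ = x₁)
    (hB₂ : ∫ θ : State, (θ : ℝ) ∂B₂ = x₂) :
    AgentsRational (linearGame k ε c α β) (truthful e he τ₁ τ₂ h₁ h₂ B₁ B₂) := by
  have hv : ∀ (i : Fin n) (B : Measure State) [IsProbabilityMeasure B],
      ∫ θ, (linearGame k ε c α β).v i θ ∂B = α i * (∫ θ : State, (θ : ℝ) ∂B) + β i := by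
    intro i B _
    simp only [linearGame]
    rw [integral_add ((integrable_state B).const_mul _) (integrable_const _), integral_const_mul]
    simp
  intro i m y hy
  have hacc : acceptProb (linearGame k ε c α β) (truthful e he τ₁ τ₂ h₁ h₂ B₁ B₂) m =
      accept ε (fun i => (truthful e he τ₁ τ₂ h₁ h₂ B₁ B₂).vote i m) := rfl
  have hvote : (truthful e he τ₁ τ₂ h₁ h₂ B₁ B₂).vote i m =
      (fun i => (truthful e he τ₁ τ₂ h₁ h₂ B₁ B₂).vote i m) i := rfl
  rw [hacc, hvote]
  rcases truthful_response (e := e) (he := he) (h₁ := h₁) (h₂ := h₂) (B₁ := B₁) (B₂ := B₂) m with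
    ⟨h, hb⟩ | ⟨h, hb⟩
  · rw [h, hb, hv, hB₂]
    exact hr₂.2.2 i y hy
  · rw [h, hb, hv, hB₁]
    exact hr₁.2.2 i y hy

variable {a b₁ b₂ : ℝ} [IsProbabilityMeasure F]

lemma lintegral_proposalLaw_truthful {f : M × State → ENNReal} (hf : Measurable f) :
    ∫⁻ y, f y ∂(proposalLaw F (poolTest a b₁ b₂) (truthful e he τ₁ τ₂ h₁ h₂ B₁ B₂)) =
      (∫⁻ θ in cell a b₁ b₂ Signal.plus₁, f (e Signal.plus₁, θ) ∂F) +
        ∫⁻ θ in cell a b₁ b₂ Signal.plus₂, f (e Signal.plus₂, θ) ∂F := by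
  have hmap : Measurable fun y : (State × Signal) × M => (y.2, y.1.1) := by fun_prop
  have hd : Measurable fun x : State × Signal =>
      ENNReal.ofReal ((truthful e he τ₁ τ₂ h₁ h₂ B₁ B₂).propose x.2) :=
    ENNReal.measurable_ofReal.comp
      ((truthful e he τ₁ τ₂ h₁ h₂ B₁ B₂).measurable_propose.comp measurable_snd)
  have hem : Measurable fun x : State × Signal => f (e x.2, x.1) :=
    hf.comp ((he.measurable.comp measurable_snd).prodMk measurable_fst)
  have hs : Measurable (Prod.snd : State × Signal → Signal) := measurable_snd
  have hg : ∀ x : State × Signal,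
      ∫⁻ m, f (m, x.1) ∂((truthful e he τ₁ τ₂ h₁ h₂ B₁ B₂).message.comap _ hs x) = f (e x.2, x.1) := by
    intro x
    rw [Kernel.comap_apply]
    exact Kernel.lintegral_deterministic' he.measurable
      (f := fun m => f (m, x.1)) (hf.comp (measurable_id.prodMk measurable_const))
  rw [proposalLaw, lintegral_map hf hmap, Measure.lintegral_compProd
    (f := fun y : (State × Signal) × M => f (y.2, y.1.1)) (hf.comp hmap)]
  simp only [hg]
  rw [lintegral_withDensity_eq_lintegral_mul _ hd hem, Measure.lintegral_compProd (hd.mul hem)]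
  have hdet : ∀ θ : State, ∫⁻ s, ((fun x : State × Signal =>
      ENNReal.ofReal ((truthful e he τ₁ τ₂ h₁ h₂ B₁ B₂).propose x.2)) *
        fun x : State × Signal => f (e x.2, x.1)) (θ, s) ∂((poolTest a b₁ b₂).rule θ) =
      (cell a b₁ b₂ Signal.plus₁).indicator (fun θ => f (e Signal.plus₁, θ)) θ +
        (cell a b₁ b₂ Signal.plus₂).indicator (fun θ => f (e Signal.plus₂, θ)) θ := by
    intro θ
    have hmem : ∀ s, θ ∈ cell a b₁ b₂ s ↔ poolSignal a b₁ b₂ θ = s := fun _ => Iff.rfl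
    rw [poolTest, Kernel.lintegral_deterministic]
    simp only [Pi.mul_apply, truthful]
    cases h : poolSignal a b₁ b₂ θ <;> simp [proposeUnlessMinus, hmem, h]
  simp only [hdet]
  have hf₁ : Measurable fun θ => f (e Signal.plus₁, θ) := hf.comp measurable_prodMk_left
  rw [lintegral_add_left (hf₁.indicator (measurableSet_cell _)),
    lintegral_indicator (measurableSet_cell _), lintegral_indicator (measurableSet_cell _)]

/-- The proposal law lives on the two messages, where it restricts F to the corresponding cell; each
belief only has to be that restriction up to its mass. -/
lemma bayesConsistent_truthful
    (hB₁ : F.restrict (cell a b₁ b₂ Signal.plus₁) = F (cell a b₁ b₂ Signal.plus₁) • B₁)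
    (hB₂ : F.restrict (cell a b₁ b₂ Signal.plus₂) = F (cell a b₁ b₂ Signal.plus₂) • B₂) :
    BayesConsistent F (poolTest a b₁ b₂) (truthful e he τ₁ τ₂ h₁ h₂ B₁ B₂) := by
  intro i
  refine Measure.ext_of_lintegral _ fun f hf => ?_
  have hg : Measurable fun m =>
      ∫⁻ θ, f (m, θ) ∂((truthful e he τ₁ τ₂ h₁ h₂ B₁ B₂).belief i m) :=
    hf.lintegral_kernel_prod_right'
  rw [Measure.lintegral_compProd hf, Measure.fst, lintegral_map hg measurable_fst,
    lintegral_proposalLaw_truthful hf,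
    lintegral_proposalLaw_truthful (f := fun y => ∫⁻ θ, f (y.1, θ)
      ∂((truthful e he τ₁ τ₂ h₁ h₂ B₁ B₂).belief i y.1)) (hg.comp measurable_fst)]
  simp only [truthful_belief_plus₁, truthful_belief_plus₂]
  rw [hB₁, hB₂]
  simp [mul_comm]

lemma induces_truthful {ℓ : ℝ} (hℓ : ℓ ∈ Icc (0 : ℝ) 1) (hℓ₁ : launch k ε τ₁ = ℓ)
    (hℓ₂ : launch k ε τ₂ = ℓ) :
    Induces (linearGame k ε c α β) (poolTest a b₁ b₂) (truthful e he τ₁ τ₂ h₁ h₂ B₁ B₂)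
      (poolOutcome a b₁ b₂ ℓ hℓ) := by
  intro θ
  simp only [launchProb_truthful hℓ₁ hℓ₂, integral_const, probReal_univ, one_smul]
  rw [poolTest, Kernel.integral_deterministic, Kernel.integral_deterministic]
  exact ⟨rfl, rfl⟩

/-- Signals are finite in number, so only those of positive probability matter, and there
multiplying by the mass of the cell preserves the sign of the proposal value. -/
lemma principalRational_truthful {ℓ : ℝ} (hℓ₁ : launch k ε τ₁ = ℓ) (hℓ₂ : launch k ε τ₂ = ℓ)
    (hminus : ℓ * (∫ θ in cell a b₁ b₂ Signal.minus, (θ : ℝ) ∂F) ≤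
      c * F.real (cell a b₁ b₂ Signal.minus))
    (hplus₁ : c * F.real (cell a b₁ b₂ Signal.plus₁) ≤
      ℓ * ∫ θ in cell a b₁ b₂ Signal.plus₁, (θ : ℝ) ∂F)
    (hplus₂ : c * F.real (cell a b₁ b₂ Signal.plus₂) ≤
      ℓ * ∫ θ in cell a b₁ b₂ Signal.plus₂, (θ : ℝ) ∂F) :
    PrincipalRational (linearGame k ε c α β) F (poolTest a b₁ b₂)
      (truthful e he τ₁ τ₂ h₁ h₂ B₁ B₂) := by
  rw [PrincipalRational, ae_iff_of_countable]
  intro s hs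
  rw [bind_poolTest_singleton] at hs
  have hpos : 0 < F.real (cell a b₁ b₂ s) :=
    ENNReal.toReal_pos hs (measure_ne_top F _)
  have hval := principalValue_mul_real (F := F) (a := a) (b₁ := b₁) (b₂ := b₂) (k := k) (ε := ε)
    (c := c) (α := α) (β := β) s
  have hpv : proposalValue (linearGame k ε c α β) F (poolTest a b₁ b₂)
      (truthful e he τ₁ τ₂ h₁ h₂ B₁ B₂) s =
      principalValue (linearGame k ε c α β) F (poolTest a b₁ b₂) s * ℓ - c := by
    simp only [proposalValue, launchProb_truthful hℓ₁ hℓ₂, integral_const, probReal_univ, one_smul]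
    rfl
  rw [hpv]
  set v := principalValue (linearGame k ε c α β) F (poolTest a b₁ b₂) s with hv
  refine ⟨fun m => by rw [launchProb_truthful hℓ₁ hℓ₂]; rfl, fun g hg => ?_⟩
  have hmul : (v * ℓ - c) * F.real (cell a b₁ b₂ s) =
      ℓ * (∫ θ in cell a b₁ b₂ s, (θ : ℝ) ∂F) - c * F.real (cell a b₁ b₂ s) := by
    rw [← hval]
    ring
  have hplus : c * F.real (cell a b₁ b₂ s) ≤ ℓ * (∫ θ in cell a b₁ b₂ s, (θ : ℝ) ∂F) →
      g * (v * ℓ - c) ≤ 1 * (v * ℓ - c) := fun h =>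
    mul_le_mul_of_nonneg_right hg.2 (nonneg_of_mul_nonneg_left (by linarith) hpos)
  cases s
  · change g * (v * ℓ - c) ≤ 0 * (v * ℓ - c)
    refine mul_le_mul_of_nonpos_right hg.1 ?_
    by_contra! hcon
    have := mul_pos hcon hpos
    linarith
  · exact hplus hplus₁
  · exact hplus hplus₂

end Truthful

lemma payoff_poolOutcome [IsProbabilityMeasure F] (hF : ∀ θ, F {θ} = 0) {k : ℕ} {ε c : ℝ}
    {α β : Fin n → ℝ} {a b₁ b₂ ℓ : ℝ} (hℓ : ℓ ∈ Icc (0 : ℝ) 1) :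
    payoff (linearGame k ε c α β) F (poolOutcome a b₁ b₂ ℓ hℓ) =
      ℓ * (moment F 1 - moment F a) - c * (1 - mass F a) := by
  have h1 : ∀ θ, ((linearGame k ε c α β).u θ * (poolOutcome a b₁ b₂ ℓ hℓ).l θ -
      (linearGame k ε c α β).c) * (poolOutcome a b₁ b₂ ℓ hℓ).p θ =
      (below a)ᶜ.indicator (fun θ : State => ℓ * (θ : ℝ) - c) θ := by
    intro θ
    by_cases h : (θ : ℝ) < a
    · have h' : θ ∉ (below a)ᶜ := fun h' => h' h
      rw [indicator_of_notMem h']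
      simp [poolOutcome, poolSignal_of_lt h, proposeUnlessMinus]
    · have h' : θ ∈ (below a)ᶜ := h
      have hs : proposeUnlessMinus (poolSignal a b₁ b₂ θ) = 1 := by
        simp only [poolSignal, h, if_false]
        split_ifs <;> rfl
      rw [indicator_of_mem h']
      simp only [poolOutcome, hs, linearGame]
      ring
  simp only [payoff, h1]
  rw [integral_indicator (measurableSet_below a).compl,
    integral_sub ((integrable_state F).const_mul ℓ).integrableOn (integrable_const _).integrableOn,
    integral_const_mul, integral_compl_below hF (integrable_state F),
    integral_compl_below hF (integrable_const c)]
  have h2 : F.real (below 1) = 1 := (tailData hF).one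
  simp only [setIntegral_const, smul_eq_mul, mass, moment, h2]
  ring

end

/-! ### The compact set of feasible plans -/

section

/-- Thresholds `(a, b₁, b₂)` and, for each of the two pools, its mean and the votes it induces. -/
abbrev Plan (n : ℕ) : Type := (ℝ × ℝ × ℝ) × (ℝ × (Fin n → ℝ)) × (ℝ × (Fin n → ℝ))

variable {n : ℕ}

/-- The plans that correspond to equilibria with truthful reporting. -/
structure IsFeasible (k : ℕ) (ε c : ℝ) (α β : Fin n → ℝ) (F : Measure State) (z : Plan n) :
    Prop where
  pool : TailData.BiPool (mass F) (moment F) z.1.1 z.1.2.1 z.1.2.2 z.2.1.1 z.2.2.1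
  reply₁ : z.2.1 ∈ replies k ε α β
  reply₂ : z.2.2 ∈ replies k ε α β
  launch_eq : launch k ε z.2.2.2 = launch k ε z.2.1.2
  forgo : launch k ε z.2.1.2 * moment F z.1.1 ≤ c * mass F z.1.1
  outer : c * ((mass F z.1.2.1 - mass F z.1.1) + (1 - mass F z.1.2.2)) ≤
    launch k ε z.2.1.2 *
      ((moment F z.1.2.1 - moment F z.1.1) + (moment F 1 - moment F z.1.2.2))
  inner : c * (mass F z.1.2.2 - mass F z.1.2.1) ≤
    launch k ε z.2.1.2 * (moment F z.1.2.2 - moment F z.1.2.1)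

/-- The principal's payoff from a plan. -/
def planValue (k : ℕ) (ε c : ℝ) (F : Measure State) (z : Plan n) : ℝ :=
  launch k ε z.2.1.2 * (moment F 1 - moment F z.1.1) - c * (1 - mass F z.1.1)

section

variable {k : ℕ} {ε c : ℝ} {α β : Fin n → ℝ} {F : Measure State} [IsProbabilityMeasure F]

/-- The conditions involve masses and moments rather than conditional means, so they remain closed
when a cell shrinks to a null set. -/
lemma isCompact_isFeasible (hF : ∀ θ, F {θ} = 0) :
    IsCompact {z : Plan n | IsFeasible k ε c α β F z} := by
  have h0 : Continuous (mass F) := (tailData hF).cont₀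
  have h1 : Continuous (moment F) := (tailData hF).cont₁
  have h2 : Continuous fun τ : Fin n → ℝ => launch k ε τ := continuous_launch k ε
  have hr := isCompact_replies k ε α β
  have hc : IsCompact ((Icc (-1 : ℝ) 1 ×ˢ Icc (-1 : ℝ) 1 ×ˢ Icc (-1 : ℝ) 1) ×ˢ
      (replies k ε α β ×ˢ replies k ε α β)) :=
    (isCompact_Icc.prod (isCompact_Icc.prod isCompact_Icc)).prod (hr.prod hr)
  have hset : {z : Plan n | IsFeasible k ε c α β F z} =
      {z : Plan n | (((-1 ≤ z.1.1 ∧ z.1.1 ≤ z.1.2.1) ∧ (z.1.2.1 ≤ z.1.2.2 ∧ z.1.2.2 ≤ 1)) ∧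
        ((moment F z.1.2.1 - moment F z.1.1) + (moment F 1 - moment F z.1.2.2) =
            z.2.1.1 * ((mass F z.1.2.1 - mass F z.1.1) + (1 - mass F z.1.2.2)) ∧
          moment F z.1.2.2 - moment F z.1.2.1 =
            z.2.2.1 * (mass F z.1.2.2 - mass F z.1.2.1))) ∧
        ((z.2.1 ∈ replies k ε α β ∧ z.2.2 ∈ replies k ε α β) ∧
          launch k ε z.2.2.2 = launch k ε z.2.1.2) ∧
        launch k ε z.2.1.2 * moment F z.1.1 ≤ c * mass F z.1.1 ∧
        (c * ((mass F z.1.2.1 - mass F z.1.1) + (1 - mass F z.1.2.2)) ≤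
          launch k ε z.2.1.2 *
            ((moment F z.1.2.1 - moment F z.1.1) + (moment F 1 - moment F z.1.2.2)) ∧
          c * (mass F z.1.2.2 - mass F z.1.2.1) ≤
            launch k ε z.2.1.2 * (moment F z.1.2.2 - moment F z.1.2.1))} := by
    ext z
    constructor
    · exact fun h => ⟨⟨⟨⟨h.pool.lower, h.pool.le₁⟩, h.pool.le₂, h.pool.upper⟩, h.pool.outer,
        h.pool.inner⟩, ⟨⟨h.reply₁, h.reply₂⟩, h.launch_eq⟩, h.forgo, h.outer, h.inner⟩
    · rintro ⟨⟨⟨⟨p1, p2⟩, p3, p4⟩, p5, p6⟩, ⟨⟨q1, q2⟩, q3⟩, q4, q5, q6⟩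
      exact ⟨⟨p1, p2, p3, p4, p5, p6⟩, q1, q2, q3, q4, q5, q6⟩
  refine hc.of_isClosed_subset ?_ fun z (hz : IsFeasible k ε c α β F z) => ?_
  · rw [hset]
    simp only [Set.ofPred_and]
    have hr₁ : IsClosed {z : Plan n | z.2.1 ∈ replies k ε α β} :=
      hr.isClosed.preimage (continuous_fst.comp continuous_snd)
    have hr₂ : IsClosed {z : Plan n | z.2.2 ∈ replies k ε α β} :=
      hr.isClosed.preimage (continuous_snd.comp continuous_snd)
    repeat' first
      | exact hr₁
      | exact hr₂
      | (refine isClosed_le ?_ ?_ <;> fun_prop)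
      | (refine isClosed_eq ?_ ?_ <;> fun_prop)
      | apply IsClosed.inter
  · have hp := hz.pool
    have h3 := hp.lower
    have h4 := hp.le₁
    have h5 := hp.le₂
    have h6 := hp.upper
    exact ⟨⟨⟨h3, by linarith⟩, ⟨by linarith, by linarith⟩, ⟨by linarith, h6⟩⟩,
      hz.reply₁, hz.reply₂⟩

lemma continuous_planValue (hF : ∀ θ, F {θ} = 0) :
    Continuous fun z : Plan n => planValue k ε c F z := by
  have h0 : Continuous (mass F) := (tailData hF).cont₀
  have h1 : Continuous (moment F) := (tailData hF).cont₁
  have h2 : Continuous fun τ : Fin n → ℝ => launch k ε τ := continuous_launch k ε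
  unfold planValue
  fun_prop

/-- Proposing always or never, whichever is better, is feasible. -/
lemma exists_isFeasible_nonneg (hε : 0 ≤ ε) (hε1 : ε ≤ 1) (hF : ∀ θ, F {θ} = 0) :
    ∃ z : Plan n, IsFeasible k ε c α β F z ∧ 0 ≤ planValue k ε c F z := by
  have hx : moment F 1 ∈ Icc (-1 : ℝ) 1 := by
    rw [moment, integral_below_one hF]
    exact abs_le.1 (abs_integral_state_le F)
  obtain ⟨τ, hτ⟩ := exists_reply k hε hε1 α β hx
  have m1 : mass F 1 = 1 := (tailData hF).one
  have m0 : mass F (-1) = 0 := (tailData hF).zero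
  have d0 := moment_neg_one F
  by_cases h : c ≤ launch k ε τ * moment F 1
  · refine ⟨((-1, 1, 1), (moment F 1, τ), (moment F 1, τ)),
      ⟨⟨?_, ?_, ?_, ?_, ?_, ?_⟩, hτ, hτ, rfl, ?_, ?_, ?_⟩, ?_⟩ <;>
      simp [planValue, m1, m0, d0, h]
  · refine ⟨((1, 1, 1), (moment F 1, τ), (moment F 1, τ)),
      ⟨⟨?_, ?_, ?_, ?_, ?_, ?_⟩, hτ, hτ, rfl, ?_, ?_, ?_⟩, ?_⟩ <;>
      simp [planValue, m1, (not_le.1 h).le]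

/-- Every feasible plan is implemented by a bi-pooled threshold test and truthful reporting. -/
lemma exists_equilibrium_of_isFeasible (hF : ∀ θ, F {θ} = 0) {M : Type*} [MeasurableSpace M]
    {e : Signal → M} (he : MeasurableEmbedding e) {z : Plan n} (hz : IsFeasible k ε c α β F z)
    (hℓ : launch k ε z.2.1.2 ∈ Icc (0 : ℝ) 1) :
    ∃ ρ : Assessment n Signal M,
      IsPublicEquilibrium (linearGame k ε c α β) F (poolTest z.1.1 z.1.2.1 z.1.2.2) ρ ∧
      Induces (linearGame k ε c α β) (poolTest z.1.1 z.1.2.1 z.1.2.2) ρ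
        (poolOutcome z.1.1 z.1.2.1 z.1.2.2 (launch k ε z.2.1.2) hℓ) ∧
      ρ.propose Signal.minus = 0 ∧ ρ.propose Signal.plus₁ = 1 ∧ ρ.propose Signal.plus₂ = 1 ∧
      ρ.message Signal.plus₁ = Measure.dirac (e Signal.plus₁) ∧
      ρ.message Signal.plus₂ = Measure.dirac (e Signal.plus₂) := by
  have hab := hz.pool.le₁
  have hb := hz.pool.le₂
  have hmom₁ : ∫ θ in cell z.1.1 z.1.2.1 z.1.2.2 Signal.plus₁, (θ : ℝ) ∂F =
      (moment F z.1.2.1 - moment F z.1.1) + (moment F 1 - moment F z.1.2.2) :=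
    integral_cell_plus₁ hF hab hb (integrable_state F)
  have hmom₂ : ∫ θ in cell z.1.1 z.1.2.1 z.1.2.2 Signal.plus₂, (θ : ℝ) ∂F =
      moment F z.1.2.2 - moment F z.1.2.1 :=
    integral_cell_plus₂ hab hb (integrable_state F)
  obtain ⟨B₁, hB₁, hrB₁, hmB₁⟩ := exists_belief (F := F)
    (C := cell z.1.1 z.1.2.1 z.1.2.2 Signal.plus₁) hz.reply₁.1
    (by rw [hmom₁, hz.pool.outer, real_cell_plus₁ hF hab hb])
  obtain ⟨B₂, hB₂, hrB₂, hmB₂⟩ := exists_belief (F := F)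
    (C := cell z.1.1 z.1.2.1 z.1.2.2 Signal.plus₂) hz.reply₂.1
    (by rw [hmom₂, hz.pool.inner, real_cell_plus₂ hab hb])
  refine ⟨truthful e he z.2.1.2 z.2.2.2 hz.reply₁.2.1 hz.reply₂.2.1 B₁ B₂, ⟨?_, ?_, ?_⟩,
    induces_truthful hℓ rfl hz.launch_eq, rfl, rfl, rfl, ?_, ?_⟩
  · refine principalRational_truthful rfl hz.launch_eq ?_ ?_ ?_
    · rw [cell_minus]
      exact hz.forgo
    · rw [hmom₁, real_cell_plus₁ hF hab hb]
      exact hz.outer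
    · rw [hmom₂, real_cell_plus₂ hab hb]
      exact hz.inner
  · exact agentsRational_truthful hz.reply₁ hz.reply₂ hmB₁ hmB₂
  · exact bayesConsistent_truthful hrB₁ hrB₂
  · exact Kernel.deterministic_apply he.measurable _
  · exact Kernel.deterministic_apply he.measurable _

/-- Every equilibrium payoff is at most the value of some feasible plan. -/
lemma exists_isFeasible_ge (hε : 0 ≤ ε) (hε1 : ε ≤ 1) (hc : 0 < c) (hF : ∀ θ, F {θ} = 0)
    {S M : Type*} [MeasurableSpace S] [MeasurableSpace M] {t : Test S} {ω : Outcome}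
    (hω : ω ∈ publicOutcomes M (linearGame k ε c α β) F t) :
    ∃ z : Plan n, IsFeasible k ε c α β F z ∧
      payoff (linearGame k ε c α β) F ω ≤ planValue k ε c F z := by
  obtain ⟨ρ, heq, hind⟩ := hω
  by_cases hpos : 0 < payoff (linearGame k ε c α β) F ω
  swap
  · obtain ⟨z, hz, hz0⟩ := exists_isFeasible_nonneg (k := k) (c := c) (α := α) (β := β) hε hε1 hF
    exact ⟨z, hz, (not_lt.1 hpos).trans hz0⟩
  obtain ⟨ℓ, hℓ0, a, b₁, b₂, x₁, ⟨⟨y₁, τ₁⟩, ⟨hr₁, hl₁⟩, rfl⟩, x₂, ⟨⟨y₂, τ₂⟩, ⟨hr₂, hl₂⟩, rfl⟩,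
    hp₁, hp₂, hpool, hval, hB⟩ := exists_biPool_of_equilibrium hε hε1 hc hF heq hind hpos
  have hl₁' : launch k ε τ₁ = ℓ := hl₁
  have hl₂' : launch k ε τ₂ = ℓ := hl₂
  have hmono := (tailData hF).mono
  have h1 : mass F 1 = 1 := (tailData hF).one
  have hp : c = ℓ * (c / ℓ) := by field_simp
  have hcell : ∀ {x v : ℝ}, c / ℓ ≤ x → 0 ≤ v → c * v ≤ ℓ * (x * v) := by
    intro x v hx hv
    rw [← mul_assoc]
    refine mul_le_mul_of_nonneg_right ?_ hv
    calc c = ℓ * (c / ℓ) := hp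
      _ ≤ ℓ * x := mul_le_mul_of_nonneg_left hx hℓ0.le
  refine ⟨((a, b₁, b₂), (y₁, τ₁), (y₂, τ₂)), ⟨hpool, hr₁, hr₂, ?_, ?_, ?_, ?_⟩, ?_⟩
  · exact hl₂'.trans hl₁'.symm
  -- At the price c / ℓ, always proposing is worth no more than proposing above a, so the states
  -- below a contribute a nonpositive amount and forgoing them is optimal.
  · have h2 := hB.trans hval
    have h3 : moment F a ≤ c / ℓ * mass F a := by
      unfold tail at h2
      rw [(tailData hF).zero, moment_neg_one] at h2
      linarith
    have h4 := mul_le_mul_of_nonneg_left h3 hℓ0.le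
    rw [← mul_assoc, ← hp] at h4
    simpa only [hl₁'] using h4
  · have h2 := hmono hpool.le₁
    have h3 := hmono hpool.upper
    rw [h1] at h3
    have := hcell hp₁ (v := (mass F b₁ - mass F a) + (1 - mass F b₂)) (by linarith)
    simpa only [hl₁', hpool.outer] using this
  · have := hcell hp₂ (sub_nonneg.2 (hmono hpool.le₂))
    simpa only [hl₁', hpool.inner] using this
  · rw [div_le_iff₀ hℓ0] at hval
    refine hval.trans_eq ?_
    simp only [planValue, hl₁', tail]
    field_simp

end

end

end PublicTest

end

/-! ### Existence of an optimal bi-pooled test -/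

theorem mainTheorem4 {n : ℕ} (hn : 2 ≤ n) (k : ℕ) (hk : 1 ≤ k) (hkn : k ≤ n)
    (ε : ℝ) (hε : 0 < ε) (hε1 : ε ≤ 1) (c : ℝ) (hc : 0 < c)
    (α β : Fin n → ℝ) (hα : ∀ i, α i = -1 ∨ α i = 1) (hβ : ∀ i, β i ∈ Set.Ioo (-1 : ℝ) 1)
    (hδ : Function.Injective fun i => -β i / α i)
    (F : MeasureTheory.Measure PublicTest.State) [MeasureTheory.IsProbabilityMeasure F]
    (hF : ∀ θ, F {θ} = 0) :
    ∃ (t : PublicTest.Test PublicTest.Signal) (ω : PublicTest.Outcome),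
      PublicTest.IsBiPooledThreshold t ∧
      -- an equilibrium of the asserted form induces `ω`, whatever the message space containing `S`
      (∀ (M : Type w₁) [MeasurableSpace M] (e : PublicTest.Signal → M), MeasurableEmbedding e →
        ∃ ρ : PublicTest.Assessment n PublicTest.Signal M,
          PublicTest.IsPublicEquilibrium (PublicTest.linearGame k ε c α β) F t ρ ∧
          PublicTest.Induces (PublicTest.linearGame k ε c α β) t ρ ω ∧
          ρ.propose PublicTest.Signal.minus = 0 ∧
          ρ.propose PublicTest.Signal.plus₁ = 1 ∧
          ρ.propose PublicTest.Signal.plus₂ = 1 ∧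
          ρ.message PublicTest.Signal.plus₁ =
            MeasureTheory.Measure.dirac (e PublicTest.Signal.plus₁) ∧
          ρ.message PublicTest.Signal.plus₂ =
            MeasureTheory.Measure.dirac (e PublicTest.Signal.plus₂)) ∧
      -- no outcome implementable by any test, with any message space, is better
      (∀ (S : Type w₂) [MeasurableSpace S] (M : Type w₃) [MeasurableSpace M]
        (t' : PublicTest.Test S),
        ∀ ω' ∈ PublicTest.publicOutcomes M (PublicTest.linearGame k ε c α β) F t',
          PublicTest.payoff (PublicTest.linearGame k ε c α β) F ω' ≤
            PublicTest.payoff (PublicTest.linearGame k ε c α β) F ω) := by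

  obtain ⟨z₀, hz₀, -⟩ := PublicTest.exists_isFeasible_nonneg (k := k) (c := c) (α := α) (β := β)
    hε.le hε1 hF
  -- The best plan is chosen without reference to any message space, so one test and one outcome
  -- serve all of them.
  obtain ⟨z, hz, hmax⟩ := (PublicTest.isCompact_isFeasible hF).exists_isMaxOn ⟨z₀, hz₀⟩
    (PublicTest.continuous_planValue (k := k) (ε := ε) (c := c) hF).continuousOn
  have hz' : PublicTest.IsFeasible k ε c α β F z := hz
  have hℓ : PublicTest.launch k ε z.2.1.2 ∈ Set.Icc (0 : ℝ) 1 :=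
    PublicTest.launch_mem k hε.le hε1 hz'.reply₁.2.1
  refine ⟨PublicTest.poolTest z.1.1 z.1.2.1 z.1.2.2,
    PublicTest.poolOutcome z.1.1 z.1.2.1 z.1.2.2 (PublicTest.launch k ε z.2.1.2) hℓ, ?_, ?_, ?_⟩
  · exact PublicTest.isBiPooledThreshold_poolTest
      ⟨hz'.pool.lower, hz'.pool.le₁.trans (hz'.pool.le₂.trans hz'.pool.upper)⟩
      hz'.pool.le₁ hz'.pool.le₂
  · intro M _ e he
    exact PublicTest.exists_equilibrium_of_isFeasible hF he hz' hℓ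
  · intro S _ M _ t' ω' hω'
    obtain ⟨z', hz', hle⟩ := PublicTest.exists_isFeasible_ge hε.le hε1 hc hF hω'
    rw [PublicTest.payoff_poolOutcome hF hℓ]
    exact hle.trans (hmax hz')
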